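/- Conventions: for a field $E$, the level $s(E)$ is the least $d$ such that $-1$ is a sum of $d$ squares in $E$ ($\infty$ if there is none); $E$ is real if $s(E)=\infty$ and nonreal otherwise. The Pythagoras number $p(E)$ is the least $d$ such that every nonzero sum of squares in $E$ is a sum of $d$ squares. A field $k$ is hereditarily pythagorean if $k$ is real and $p(L)=1$ for every finite real extension $L/k$. A field extension $E/k$ is ruled if $E$ is a rational function field in one variable over some finite extension of $k$. Writing $E=k(X)(\sqrt{f})$ for $f\in k[X]$ means that $E=k(x,y)$ with $x$ transcendental over $k$ and $y^2=f(x)$. For a valuation $v$, $\kappa_v$ denotes its residue field. Proposition. Let $g\in\mathbb{N}=\{0,1,2,\dots\}$. Let $K$ be a field with a henselian valuation $v$ with value group $\mathbb{Z}$ such that $\kappa_v$ is hereditarily pythagorean. Let $f\in K[X]$ be a square-free polynomial of degree $2g+2$ all of whose roots (in an algebraic closure of $K$) lie in $K(\sqrt{-1})\setminus K$, and let $F=K(X)(\sqrt{f})$. Assume that $F$ is real. Let $w$ be an extension of $v$ to a valuation on $F$ such that $\kappa_w/\kappa_v$ is transcendental. Then at least one of the following holds: (a) $\kappa_w$ is nonreal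 and $s(\kappa_w)=1$; (b) $\kappa_w/\kappa_v$ is ruled; (c) $\kappa_w$ is a real field and $\kappa_w=\kappa_v(X)(\sqrt{h})$ for some square-free polynomial $h\in\kappa_v[X]$ all of whose roots (in an algebraic closure of $\kappa_v$) lie in $\kappa_v(\sqrt{-1})\setminus\kappa_v$. -/

import Mathlib

open Polynomial

/-- `S_d(K)`: the nonzero sums of `d` squares in `K` (zero summands are allowed). -/
def sumsOfSquares (K : Type*) [Field K] (d : ℕ) : Set K :=
  {a | a ≠ 0 ∧ ∃ x : Fin d → K, a = ∑ i, x i ^ 2}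

/-- `S(K)`: the nonzero sums of squares in `K`. -/
def allSumsOfSquares (K : Type*) [Field K] : Set K :=
  ⋃ d : ℕ, sumsOfSquares K d

/-- The Pythagoras number `p(K)`: the least `d` with `S(K) = S_d(K)`, and `⊤` if there is none. -/
noncomputable def pythagorasNumber (K : Type*) [Field K] : ℕ∞ :=
  ⨅ (d : ℕ) (_ : allSumsOfSquares K = sumsOfSquares K d), (d : ℕ∞)

/-- The level `s(K)`: the least `d` such that `-1` is a sum of `d` squares in `K`, and `⊤` if
there is none. -/
noncomputable def fieldLevel (K : Type*) [Field K] : ℕ∞ :=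
  ⨅ (d : ℕ) (_ : (-1 : K) ∈ sumsOfSquares K d), (d : ℕ∞)

/-- A field is real (that is, of infinite level) if and only if it is semireal in the sense of
Mathlib. -/
theorem fieldLevel_eq_top_iff (K : Type*) [Field K] : fieldLevel K = ⊤ ↔ IsSemireal K := by
  rw [isSemireal_iff_not_isSumSq_neg_one]
  simp only [fieldLevel, iInf_eq_top, ENat.natCast_ne_top, imp_false]
  constructor
  · intro h hs
    have key : ∀ a : K, IsSumSq a → ∃ d : ℕ, ∃ x : Fin d → K, a = ∑ i, x i ^ 2 := by
      intro a ha
      induction ha with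
      | zero => exact ⟨0, Fin.elim0, by simp⟩
      | sq_add b _ ih =>
        obtain ⟨d, x, hx⟩ := ih
        exact ⟨d + 1, Fin.cons b x, by simp [Fin.sum_univ_succ, hx, sq]⟩
    obtain ⟨d, x, hx⟩ := key _ hs
    exact h d ⟨neg_ne_zero.mpr one_ne_zero, x, hx⟩
  · rintro h d ⟨-, x, hx⟩
    apply h
    rw [hx]
    exact IsSumSq.sum fun i _ => by rw [sq]; exact IsSumSq.mul_self _

/-- The field `K` is hereditarily pythagorean: it is real, and every finite real extension of `K`
has Pythagoras number `1`. -/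
def IsHereditarilyPythagorean.{u} (K : Type u) [Field K] : Prop :=
  IsSemireal K ∧ ∀ (L : Type u) [Field L] [Algebra K L] [FiniteDimensional K L],
    IsSemireal L → pythagorasNumber L = 1

/-- `F/K` is ruled: `F` is a rational function field (in one variable) over some finite extension
of `K`. -/
def IsRuledExtension (K F : Type*) [Field K] [Field F] [Algebra K F] : Prop :=
  ∃ l : IntermediateField K F, FiniteDimensional K l ∧
    ∃ t : F, Transcendental l t ∧ IntermediateField.adjoin l {t} = ⊤

/-- `F = K(X)(√f)`: the extension `F/K` is generated by an element `x` transcendental over `K` and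
an element `y` with `y² = f(x)`. -/
def IsRationalAdjoinSqrt (K F : Type*) [Field K] [Field F] [Algebra K F] (f : K[X]) : Prop :=
  ∃ x y : F, Transcendental K x ∧ y ^ 2 = aeval x f ∧ IntermediateField.adjoin K {x, y} = ⊤

/-- All roots of `f` (in an algebraic closure of `K`) lie in `K(√-1) ∖ K`. -/
def RootsInAdjoinSqrtNegOne {K : Type*} [Field K] (f : K[X]) : Prop :=
  ∀ z : AlgebraicClosure K, aeval z f = 0 →
    z ∈ IntermediateField.adjoin K {i : AlgebraicClosure K | i ^ 2 = -1} ∧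
      z ∉ (⊥ : IntermediateField K (AlgebraicClosure K))

/-! Write `k` for the residue field of `v`. If `-1` is a square in the residue field of `w`, case
(a) holds; suppose it is not. Up to a constant, `f` is a product `N` of quadratics `(X - a)² + b²`
with `b ≠ 0`. As `-1` is not a residual square, a sum of two squares never has smaller value than
its larger term, so the value of `N(x)` can be read off from the values of `x - a` and of constants.
Call an element of `F` tame if some power of it is a constant times a unit whose residue is
algebraic over `k`.

If every `x - a` is tame, then so is `y² = f(x)`. If the value of some `x - a` is not that of a
constant, then `N(x)` is tame up to a square in `K(x)`, and rescaling `y` makes `y²` tame. In both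
cases `isRuledExtension_of_isTame` gives (b). A polynomial `Q` of least degree with `Q(x)` not tame
yields a transcendental residue `Z` of `Q(x)^e / s`, with `s` tame, and the residues of `K(x)` lie
in `L(Z)`, where `L` is the algebraic closure of `k` in the residue field of `w`. A unit multiple of
`y`, if there is one, can be chosen so that its residue has as square an element of `L` times a
power of `Z`. So the residue field of `w` is generated over `L` by one element. The extension `L/k`
is finite because its degree is at most `[F : K(t)]` for a lift `t` of a transcendental residue.

In the remaining case some `x - a` has the value of a constant `c`, and the residue `Z` of `(x -
a)/c` is transcendental. Then `w` is a Gauss valuation on `K(x)`, with residue field `k(Z)`, and the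
quadratic factors of `f` reduce to sums of two squares in `k[Z]`. The residue field of `w` is
`k(Z)`, which is ruled, or it arises by adjoining a square root of a constant `ū` times a product of
quadratics in `Z` (`isRuledExtension_or_of_linear`). If `-ū` were a sum of squares, it would be a
square since `k` is pythagorean; by Hensel `-f` would be a sum of two squares, contradicting that
`F` is real. So `isSemireal_of_adjoin_sqrt` applies and gives (c). -/

/-! ### Residues of elements under a valuation. -/

section Residue

variable {F Γ : Type*} [Field F] [LinearOrderedCommGroupWithZero Γ]

/-- The residue field of a valuation. -/
abbrev ResF (w : Valuation F Γ) := IsLocalRing.ResidueField w.valuationSubring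

open Classical in
/-- The residue of an element with respect to a valuation, with value `0` outside the valuation
ring. -/
noncomputable def resid (w : Valuation F Γ) (z : F) : ResF w :=
  if h : w z ≤ 1 then IsLocalRing.residue w.valuationSubring ⟨z, h⟩ else 0

variable {w : Valuation F Γ} {x y : F}

theorem resid_of_le (h : w x ≤ 1) :
    resid w x = IsLocalRing.residue w.valuationSubring ⟨x, h⟩ := dif_pos h

theorem exists_resid_eq (r : ResF w) : ∃ z, w z ≤ 1 ∧ resid w z = r := by
  obtain ⟨⟨z, hz⟩, rfl⟩ := IsLocalRing.residue_surjective r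
  exact ⟨z, hz, resid_of_le hz⟩

theorem resid_add (hx : w x ≤ 1) (hy : w y ≤ 1) :
    resid w (x + y) = resid w x + resid w y := by
  rw [resid_of_le hx, resid_of_le hy, resid_of_le (w.map_add_le hx hy), ← map_add]; rfl

theorem resid_mul (hx : w x ≤ 1) (hy : w y ≤ 1) :
    resid w (x * y) = resid w x * resid w y := by
  have h : w (x * y) ≤ 1 := by rw [map_mul]; exact mul_le_one' hx hy
  rw [resid_of_le hx, resid_of_le hy, resid_of_le h, ← map_mul]; rfl

@[simp] theorem resid_one : resid w (1 : F) = 1 := by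
  rw [resid_of_le (w := w) (x := 1) (by simp), ← map_one (IsLocalRing.residue _)]; rfl

@[simp] theorem resid_zero : resid w (0 : F) = 0 := by
  rw [resid_of_le (w := w) (x := 0) (by simp), ← map_zero (IsLocalRing.residue _)]; rfl

theorem resid_eq_zero_iff (hx : w x ≤ 1) : resid w x = 0 ↔ w x < 1 := by
  rw [resid_of_le hx, IsLocalRing.residue_eq_zero_iff]
  exact w.mem_maximalIdeal_iff

theorem resid_eq_zero (hx : w x < 1) : resid w x = 0 := (resid_eq_zero_iff hx.le).2 hx

theorem resid_ne_zero (hx : w x = 1) : resid w x ≠ 0 := by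
  rw [Ne, resid_eq_zero_iff hx.le, hx]; exact lt_irrefl _

theorem val_eq_one_of_resid_ne_zero (hx : w x ≤ 1) (h : resid w x ≠ 0) : w x = 1 :=
  le_antisymm hx (not_lt.1 fun h' => h (resid_eq_zero h'))

theorem resid_neg (hx : w x ≤ 1) : resid w (-x) = -resid w x := by
  rw [eq_neg_iff_add_eq_zero, ← resid_add (by rwa [Valuation.map_neg]) hx, neg_add_cancel,
    resid_zero]

theorem resid_eq_of_sub_lt (hy : w y ≤ 1) (h : w (x - y) < 1) : resid w x = resid w y := by
  have := resid_add h.le hy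
  rwa [sub_add_cancel, resid_eq_zero h, zero_add] at this

theorem resid_pow (hx : w x ≤ 1) (n : ℕ) : resid w (x ^ n) = resid w x ^ n := by
  induction n with
  | zero => simp
  | succ n ih => rw [pow_succ, resid_mul (by rw [map_pow]; exact pow_le_one' hx n) hx, ih, pow_succ]

theorem resid_inv (hx : w x = 1) : resid w x⁻¹ = (resid w x)⁻¹ := by
  have h0 : x ≠ 0 := by rintro rfl; simp at hx
  refine eq_inv_of_mul_eq_one_left ?_
  rw [← resid_mul (by simp [hx]) hx.le, inv_mul_cancel₀ h0, resid_one]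

theorem resid_zpow (hx : w x = 1) (n : ℤ) : resid w (x ^ n) = resid w x ^ n := by
  cases n with
  | ofNat n => simpa using resid_pow hx.le n
  | negSucc n =>
    rw [zpow_negSucc, zpow_negSucc, resid_inv (by simp [hx]), resid_pow hx.le]

theorem resid_sum {ι : Type*} (s : Finset ι) (u : ι → F) (hu : ∀ i ∈ s, w (u i) ≤ 1) :
    resid w (∑ i ∈ s, u i) = ∑ i ∈ s, resid w (u i) := by
  classical
  induction s using Finset.induction_on with
  | empty => simp
  | insert a s ha ih =>
    rw [Finset.sum_insert ha, Finset.sum_insert ha, resid_add (hu _ (by simp)), ih]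
    · exact fun i hi => hu i (by simp [hi])
    · exact w.map_sum_le fun i hi => hu i (by simp [hi])

theorem resid_algebraMap {K Γ₀ : Type*} [Field K] [LinearOrderedCommGroupWithZero Γ₀]
    [Algebra K F] (v : Valuation K Γ₀) (w : Valuation F Γ) [v.HasExtension w] {c : K}
    (hc : v c ≤ 1) :
    resid w (algebraMap K F c) = algebraMap (ResF v) (ResF w) (resid v c) := by
  rw [resid_of_le hc, resid_of_le ((Valuation.HasExtension.val_map_le_one_iff v w c).2 hc)]
  rfl

end Residue

/-! ### Sums of squares in fields and in rational function fields. -/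

section SumsOfSquares

theorem exists_eq_sum_sq {E : Type*} [Field E] {a : E} (ha : IsSumSq a) :
    ∃ d : ℕ, ∃ x : Fin d → E, a = ∑ i, x i ^ 2 := by
  induction ha with
  | zero => exact ⟨0, Fin.elim0, by simp⟩
  | sq_add b _ ih =>
    obtain ⟨d, x, hx⟩ := ih
    exact ⟨d + 1, Fin.cons b x, by simp [Fin.sum_univ_succ, hx, sq]⟩

theorem exists_eq_sq_of_pythagorasNumber_eq_one {E : Type*} [Field E]
    (h : pythagorasNumber E = 1) {a : E} (ha : IsSumSq a) : ∃ b, a = b ^ 2 := by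
  by_cases ha0 : a = 0
  · exact ⟨0, by simp [ha0]⟩
  have h1 : allSumsOfSquares E = sumsOfSquares E 1 := by
    have hlt : pythagorasNumber E < 2 := by rw [h]; norm_num
    unfold pythagorasNumber at hlt
    simp only [iInf_lt_iff] at hlt
    obtain ⟨d, hd, hd2⟩ := hlt
    have : d < 2 := by exact_mod_cast hd2
    have hle : pythagorasNumber E ≤ d := iInf₂_le d hd
    rw [h] at hle
    have : 1 ≤ d := by exact_mod_cast hle
    obtain rfl : d = 1 := by omega
    exact hd
  obtain ⟨d, x, hx⟩ := exists_eq_sum_sq ha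
  have : a ∈ allSumsOfSquares E := Set.mem_iUnion.2 ⟨d, ha0, x, hx⟩
  rw [h1] at this
  obtain ⟨-, y, hy⟩ := this
  exact ⟨y 0, by simpa using hy⟩

theorem level_one_of_sq_eq_neg_one {E : Type*} [Field E] {i : E} (hi : i ^ 2 = -1) :
    ¬ IsSemireal E ∧ fieldLevel E = 1 := by
  constructor
  · rw [isSemireal_iff_not_isSumSq_neg_one, not_not, ← hi, sq]
    exact IsSumSq.mul_self _
  · apply le_antisymm
    · exact iInf₂_le_of_le 1 ⟨neg_ne_zero.2 one_ne_zero, fun _ => i, by simp [hi]⟩ (by simp)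
    · refine le_iInf₂ fun d hd => ?_
      rcases Nat.eq_zero_or_pos d with rfl | hd0
      · obtain ⟨h0, x, hx⟩ := hd
        simp at hx
      · exact_mod_cast hd0

theorem IsSumSq.inv_field {E : Type*} [Field E] {a : E} (ha : IsSumSq a) : IsSumSq a⁻¹ := by
  by_cases h : a = 0
  · simp [h]
  have : a⁻¹ = a * (a⁻¹ * a⁻¹) := by field_simp
  rw [this]
  exact ha.mul (IsSumSq.mul_self _)

theorem IsSumSq.eq_zero_of_add_eq_zero {E : Type*} [Field E] [IsSemireal E] {a b : E}
    (ha : IsSumSq a) (hb : IsSumSq b) (h : a + b = 0) : b = 0 := by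
  by_contra hb0
  refine IsSemireal.not_isSumSq_neg_one (R := E) ?_
  have : (-1 : E) = a * b⁻¹ := by
    rw [eq_neg_of_add_eq_zero_left h]; field_simp
  rw [this]
  exact ha.mul hb.inv_field

/-- Over a real field the leading coefficients of squares cannot cancel. -/
theorem IsSumSq.leadingCoeff {E : Type*} [Field E] [IsSemireal E] {P : E[X]} (hP : IsSumSq P) :
    IsSumSq P.leadingCoeff := by
  induction hP with
  | zero => simp
  | @sq_add b s hs ih =>
    have hb : IsSumSq (b * b).leadingCoeff := by
      rw [leadingCoeff_mul]; exact IsSumSq.mul_self _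
    rcases lt_trichotomy (b * b).degree s.degree with h | h | h
    · rwa [leadingCoeff_add_of_degree_lt h]
    · by_cases h0 : (b * b).leadingCoeff + s.leadingCoeff = 0
      · have hs0 := hb.eq_zero_of_add_eq_zero ih h0
        rw [leadingCoeff_eq_zero] at hs0
        subst hs0
        simp
      · rw [leadingCoeff_add_of_degree_eq h h0]
        exact hb.add ih
    · rwa [leadingCoeff_add_of_degree_lt' h]

/-- An element of a real field `k` which is a sum of squares in the rational function field
`k(Z)` is a sum of squares in `k`. -/
theorem IsSumSq.of_algebraMap_adjoin {k E : Type*} [Field k] [Field E] [Algebra k E]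
    [IsSemireal k] {Z : E} (hZ : Transcendental k Z) {r : k}
    (hr : IsSumSq (algebraMap k (IntermediateField.adjoin k {Z}) r)) : IsSumSq r := by
  have key : ∀ s : IntermediateField.adjoin k {Z}, IsSumSq s → ∃ D P : k[X], D ≠ 0 ∧ IsSumSq P ∧
      (s : E) * aeval Z D ^ 2 = aeval Z P := by
    intro s hs
    induction hs with
    | zero => exact ⟨1, 0, one_ne_zero, IsSumSq.zero, by simp⟩
    | @sq_add a s _ ih =>
      obtain ⟨D, P, hD, hP, h⟩ := ih
      obtain ⟨A, B, hAB⟩ := (IntermediateField.mem_adjoin_simple_iff k (a : E)).1 a.2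
      by_cases hB : aeval Z B = 0
      · refine ⟨D, P, hD, hP, ?_⟩
        simp [hAB, hB, h]
      · refine ⟨B * D, A * D * (A * D) + B * B * P, mul_ne_zero ?_ hD,
          (IsSumSq.mul_self _).add ((IsSumSq.mul_self _).mul hP), ?_⟩
        · rintro rfl; simp at hB
        · simp only [map_mul, map_add, ← h]
          push_cast
          rw [hAB]
          field_simp
  -- Clearing denominators gives `r D² = P` with `P` a sum of squares in `k[X]`; compare leading
  -- coefficients.
  obtain ⟨D, P, hD, hP, h⟩ := key _ hr
  have hinj := transcendental_iff_injective.1 hZ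
  have h2 : C r * D ^ 2 = P := by
    apply hinj
    rw [← h]
    simp
  have h3 := hP.leadingCoeff
  rw [← h2, leadingCoeff_mul, leadingCoeff_C, leadingCoeff_pow] at h3
  have hD' : D.leadingCoeff ≠ 0 := leadingCoeff_ne_zero.2 hD
  have : r = r * D.leadingCoeff ^ 2 * (D.leadingCoeff⁻¹ * D.leadingCoeff⁻¹) := by
    field_simp
  rw [this]
  exact h3.mul (IsSumSq.mul_self _)

end SumsOfSquares

/-! ### Polynomials with all roots in `K(√-1) ∖ K`. -/

section Quadratics

/-- The multiplicative monoid generated by the polynomials `(X - a)² + b²` with `b ≠ 0`. -/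
noncomputable def quadMonoid (K : Type*) [Field K] : Submonoid K[X] :=
  Submonoid.closure {P | ∃ a b : K, b ≠ 0 ∧ P = (X - C a) ^ 2 + C (b ^ 2)}

variable {K : Type*} [Field K]

theorem quad_monic (a b : K) : ((X - C a) ^ 2 + C (b ^ 2)).Monic ∧
    ((X - C a) ^ 2 + C (b ^ 2)).natDegree = 2 := by
  have h : (X - C a) ^ 2 + C (b ^ 2) = X ^ 2 + (C (-2 * a) * X + C (a ^ 2 + b ^ 2)) := by
    simp only [map_mul, map_add, map_neg, map_pow, map_ofNat]; ring
  rw [h]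
  have hd : (C (-2 * a) * X + C (a ^ 2 + b ^ 2)).degree < 2 :=
    (degree_linear_le).trans_lt (by norm_num)
  refine ⟨monic_X_pow_add (n := 2) (by exact_mod_cast hd), ?_⟩
  rw [natDegree_add_eq_left_of_degree_lt (by rwa [degree_X_pow]), natDegree_X_pow]

theorem ne_zero_of_mem_quadMonoid {N : K[X]} (hN : N ∈ quadMonoid K) : N ≠ 0 := by
  induction hN using Submonoid.closure_induction with
  | mem x h => obtain ⟨a, b, -, rfl⟩ := h; exact (quad_monic a b).1.ne_zero
  | one => exact one_ne_zero
  | mul x y _ _ hx hy => exact mul_ne_zero hx hy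

theorem exists_add_sq_of_mem_quadMonoid {N : K[X]} (hN : N ∈ quadMonoid K) :
    ∃ p q : K[X], N = p ^ 2 + q ^ 2 := by
  induction hN using Submonoid.closure_induction with
  | mem x h => obtain ⟨a, b, -, rfl⟩ := h; exact ⟨X - C a, C b, by simp⟩
  | one => exact ⟨1, 0, by simp⟩
  | mul x y _ _ hx hy =>
    obtain ⟨p, q, rfl⟩ := hx
    obtain ⟨r, s, rfl⟩ := hy
    exact ⟨p * r - q * s, p * s + q * r, by ring⟩

theorem rootsInAdjoin_of_mem_quadMonoid (hi : ¬ ∃ i : K, i ^ 2 = -1) {N : K[X]}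
    (hN : N ∈ quadMonoid K) : RootsInAdjoinSqrtNegOne N := by
  induction hN using Submonoid.closure_induction with
  | mem x h =>
    obtain ⟨a, b, hb, rfl⟩ := h
    intro z hz
    have hb' : algebraMap K (AlgebraicClosure K) b ≠ 0 := by simpa using hb
    have hz' : (z - algebraMap K _ a) ^ 2 + algebraMap K _ b ^ 2 = 0 := by simpa using hz
    constructor
    · have hs : (z - algebraMap K _ a) / algebraMap K _ b ∈ IntermediateField.adjoin K
          {i : AlgebraicClosure K | i ^ 2 = -1} := by
        apply IntermediateField.subset_adjoin
        change _ ^ 2 = _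
        rw [div_pow, eq_neg_of_add_eq_zero_left hz']
        field_simp
      have := add_mem (mul_mem hs (IntermediateField.algebraMap_mem _ b))
        (IntermediateField.algebraMap_mem _ a)
      rwa [div_mul_cancel₀ _ hb', sub_add_cancel] at this
    · intro hbot
      obtain ⟨r, rfl⟩ := IntermediateField.mem_bot.1 hbot
      rw [← map_sub, ← map_pow, ← map_pow, ← map_add, map_eq_zero] at hz'
      refine hi ⟨(r - a) / b, ?_⟩
      rw [div_pow, eq_neg_of_add_eq_zero_left hz']
      field_simp
  | one => intro z hz; simp at hz
  | mul x y _ _ hx hy =>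
    intro z hz
    rw [map_mul, mul_eq_zero] at hz
    exact hz.elim (hx z) (hy z)

theorem RootsInAdjoinSqrtNegOne.of_dvd {P Q : K[X]} (hQ : RootsInAdjoinSqrtNegOne Q)
    (h : P ∣ Q) : RootsInAdjoinSqrtNegOne P := by
  intro z hz
  obtain ⟨R, rfl⟩ := h
  exact hQ z (by rw [map_mul, hz, zero_mul])

theorem exists_of_mem_adjoin_sqrt_neg_one {z : AlgebraicClosure K}
    (hz : z ∈ IntermediateField.adjoin K {i : AlgebraicClosure K | i ^ 2 = -1}) :
    ∃ a b : K, (z - algebraMap K _ a) ^ 2 + algebraMap K _ b ^ 2 = 0 := by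
  obtain ⟨i, hi⟩ : ∃ i : AlgebraicClosure K, i ^ 2 = -1 := by
    obtain ⟨i, hi⟩ := IsAlgClosed.exists_pow_nat_eq (-1 : AlgebraicClosure K) (n := 2) (by norm_num)
    exact ⟨i, hi⟩
  suffices h : ∃ a b : K, z = algebraMap K _ a + algebraMap K _ b * i by
    obtain ⟨a, b, rfl⟩ := h
    exact ⟨a, b, by linear_combination (algebraMap K _ b) ^ 2 * hi⟩
  have hz' : z ∈ Algebra.adjoin K {i : AlgebraicClosure K | i ^ 2 = -1} := by
    rw [← IntermediateField.adjoin_toSubalgebra_of_isAlgebraic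
      (fun x _ => Algebra.IsAlgebraic.isAlgebraic x)]
    exact hz
  clear hz
  induction hz' using Algebra.adjoin_induction with
  | mem x hx =>
    have : (x - i) * (x + i) = 0 := by
      have : x ^ 2 = -1 := hx
      linear_combination this - hi
    rcases mul_eq_zero.1 this with h | h
    · exact ⟨0, 1, by simp; linear_combination h⟩
    · exact ⟨0, -1, by simp; linear_combination h⟩
  | algebraMap r => exact ⟨r, 0, by simp⟩
  | add x y _ _ hx hy =>
    obtain ⟨a, b, hx⟩ := hx
    obtain ⟨c, d, hy⟩ := hy
    exact ⟨a + c, b + d, by rw [hx, hy]; simp only [map_add]; ring⟩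
  | mul x y _ _ hx hy =>
    obtain ⟨a, b, hx⟩ := hx
    obtain ⟨c, d, hy⟩ := hy
    refine ⟨a * c - b * d, a * d + b * c, ?_⟩
    rw [hx, hy]; simp only [map_add, map_sub, map_mul]
    linear_combination (algebraMap K (AlgebraicClosure K) b * algebraMap K _ d) * hi

/-- A root `a + b√-1` outside `K` has minimal polynomial `(X - a)² + b²`; split it off and induct on
the degree. -/
theorem exists_eq_C_mul_quad {P : K[X]} (hP : P ≠ 0) (hr : RootsInAdjoinSqrtNegOne P) :
    ∃ c : K, c ≠ 0 ∧ ∃ N ∈ quadMonoid K, P = C c * N := by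
  induction hn : P.natDegree using Nat.strong_induction_on generalizing P with
  | _ n ih =>
    by_cases hd : P.degree = 0
    · rw [eq_C_of_degree_eq_zero hd] at hP ⊢
      exact ⟨P.coeff 0, by simpa using hP, 1, one_mem _, by simp⟩
    obtain ⟨z, hz⟩ := IsAlgClosed.exists_aeval_eq_zero (AlgebraicClosure K) P hd
    obtain ⟨hz1, hz2⟩ := hr z hz
    obtain ⟨a, b, hab⟩ := exists_of_mem_adjoin_sqrt_neg_one hz1
    have hb : b ≠ 0 := by
      rintro rfl
      apply hz2
      rw [map_zero, zero_pow two_ne_zero, add_zero, sq_eq_zero_iff, sub_eq_zero] at hab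
      rw [hab]; exact IntermediateField.algebraMap_mem _ _
    have hint : IsIntegral K z := Algebra.IsIntegral.isIntegral z
    have hmin : minpoly K z = (X - C a) ^ 2 + C (b ^ 2) := by
      symm
      refine eq_of_monic_of_dvd_of_natDegree_le (minpoly.monic hint) (quad_monic a b).1
        (minpoly.dvd K z (by simpa using hab)) ?_
      rw [(quad_monic a b).2]
      exact (minpoly.two_le_natDegree_iff hint).2 fun ⟨r, h⟩ =>
        hz2 (h ▸ IntermediateField.algebraMap_mem _ _)
    obtain ⟨R, rfl⟩ := hmin ▸ minpoly.dvd K z hz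
    have hR : R ≠ 0 := right_ne_zero_of_mul hP
    obtain ⟨c, hc, N, hN, rfl⟩ := ih R.natDegree
      (by rw [← hn, natDegree_mul (left_ne_zero_of_mul hP) hR, (quad_monic a b).2]; omega) hR
      (hr.of_dvd (dvd_mul_left _ _)) rfl
    exact ⟨c, hc, _, mul_mem (Submonoid.subset_closure ⟨a, b, hb, rfl⟩) hN, by ring⟩

theorem exists_squarefree_mul_sq {P : K[X]} (hP : P ≠ 0) :
    ∃ h s : K[X], Squarefree h ∧ P = h * s ^ 2 := by
  induction hn : P.natDegree using Nat.strong_induction_on generalizing P with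
  | _ n ih =>
    by_cases hs : Squarefree P
    · exact ⟨P, 1, hs, by simp⟩
    rw [Squarefree] at hs
    push Not at hs
    obtain ⟨x, ⟨R, rfl⟩, hx⟩ := hs
    have hx0 : x ≠ 0 := by rintro rfl; simp at hP
    have hR : R ≠ 0 := right_ne_zero_of_mul hP
    obtain ⟨h, s, hh, rfl⟩ := ih R.natDegree (by
      rw [← hn, natDegree_mul (left_ne_zero_of_mul hP) hR, natDegree_mul hx0 hx0]
      have : x.natDegree ≠ 0 := fun h0 => hx (isUnit_iff_degree_eq_zero.2
        ((degree_eq_iff_natDegree_eq hx0).2 h0))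
      omega) hR rfl
    exact ⟨h, s * x, hh, by ring⟩

end Quadratics

/-! ### Generation of quadratic and ruled extensions. -/

section Extensions

variable {K F : Type*} [Field K] [Field F] [Algebra K F]

theorem exists_eq_add_mul_of_adjoin_eq_top (E : IntermediateField K F) {y : F} (hy : y ^ 2 ∈ E)
    (htop : ∀ M : IntermediateField K F, E ≤ M → y ∈ M → M = ⊤) (z : F) :
    ∃ a ∈ E, ∃ b ∈ E, z = a + b * y := by
  by_cases hyE : y ∈ E
  · have := htop E le_rfl hyE
    exact ⟨z, this ▸ IntermediateField.mem_top, 0, zero_mem _, by simp⟩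
  have hne : ∀ a ∈ E, ∀ b ∈ E, a + b * y = 0 → b = 0 := by
    intro a ha b hb h
    by_contra hb0
    apply hyE
    have : y = -a / b := by field_simp; linear_combination h
    rw [this]
    exact div_mem (neg_mem ha) hb
  let S : Subalgebra K F :=
    { carrier := {z | ∃ a ∈ E, ∃ b ∈ E, z = a + b * y}
      mul_mem' := by
        rintro _ _ ⟨a, ha, b, hb, rfl⟩ ⟨c, hc, d, hd, rfl⟩
        exact ⟨a * c + b * d * y ^ 2, add_mem (mul_mem ha hc) (mul_mem (mul_mem hb hd) hy),
          a * d + b * c, add_mem (mul_mem ha hd) (mul_mem hb hc), by ring⟩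
      add_mem' := by
        rintro _ _ ⟨a, ha, b, hb, rfl⟩ ⟨c, hc, d, hd, rfl⟩
        exact ⟨a + c, add_mem ha hc, b + d, add_mem hb hd, by ring⟩
      algebraMap_mem' := fun r => ⟨_, E.algebraMap_mem r, 0, zero_mem _, by simp⟩ }
  let M : IntermediateField K F := S.toIntermediateField (by
    rintro _ ⟨a, ha, b, hb, rfl⟩
    by_cases h0 : a + b * y = 0
    · rw [h0, inv_zero]; exact zero_mem S
    have hn : a ^ 2 - b ^ 2 * y ^ 2 ≠ 0 := by
      intro h
      have : (a + b * y) * (a + -b * y) = 0 := by linear_combination h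
      have h2 := (mul_eq_zero.1 this).resolve_left h0
      have hb0 : b = 0 := by simpa using hne a ha (-b) (neg_mem hb) h2
      subst hb0
      simp at h0 h2
      exact h0 h2
    have hnE : a ^ 2 - b ^ 2 * y ^ 2 ∈ E :=
      sub_mem (pow_mem ha 2) (mul_mem (pow_mem hb 2) hy)
    refine ⟨a / (a ^ 2 - b ^ 2 * y ^ 2), div_mem ha hnE, -b / (a ^ 2 - b ^ 2 * y ^ 2),
      div_mem (neg_mem hb) hnE, ?_⟩
    field_simp
    ring)
  have hM : M = ⊤ := htop M (fun a ha => ⟨a, ha, 0, zero_mem _, by simp⟩)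
    ⟨0, zero_mem _, 1, one_mem _, by simp⟩
  have : z ∈ M := hM ▸ IntermediateField.mem_top
  exact this

/-- Generation is tested against all intermediate fields `M`, since residue fields are determined
below by showing that every residue lies in a given `M`. -/
theorem IsRuledExtension.of_adjoin (L : IntermediateField K F) [FiniteDimensional K L] {Z : F}
    (hZ : Transcendental K Z)
    (htop : ∀ M : IntermediateField K F, L ≤ M → Z ∈ M → M = ⊤) : IsRuledExtension K F := by
  refine ⟨L, inferInstance, Z, hZ.extendScalars L, ?_⟩
  apply IntermediateField.restrictScalars_injective K
  rw [IntermediateField.restrictScalars_top]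
  apply htop
  · intro l hl
    rw [IntermediateField.mem_restrictScalars]
    exact IntermediateField.algebraMap_mem _ (⟨l, hl⟩ : L)
  · rw [IntermediateField.mem_restrictScalars]
    exact IntermediateField.mem_adjoin_simple_self L Z

end Extensions

theorem exists_aeval_eq_of_mem_adjoin_singleton {K F : Type*} [Field K] [Field F] [Algebra K F]
    {t z : F} (hz : z ∈ Algebra.adjoin K {t}) : ∃ q : K[X], aeval t q = z := by
  rw [Algebra.adjoin_singleton_eq_range_aeval] at hz
  exact hz

theorem finiteDimensional_of_card_le {k V : Type*} [Field k] [AddCommGroup V] [Module k V] {n : ℕ}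
    (h : ∀ s : Finset V, LinearIndependent k (fun i : s => (i : V)) → s.card ≤ n) :
    FiniteDimensional k V :=
  Module.rank_lt_aleph0_iff.1 ((rank_le h).trans_lt Cardinal.natCast_lt_aleph0)

/-! ### Values and residues over a Gauss valuation. -/

section Gauss

variable {K F Γ₀ Γ : Type*} [Field K] [Field F] [Algebra K F]
  [LinearOrderedCommGroupWithZero Γ₀] [LinearOrderedCommGroupWithZero Γ]
  (v : Valuation K Γ₀) (w : Valuation F Γ) [v.HasExtension w]

/-- Dividing by the coefficient of largest value leaves a sum whose residue is a nontrivial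
combination of independent residues, hence nonzero. -/
theorem val_sum_eq {ι : Type*} {s : Finset ι} {x : ι → F} (hx : ∀ i, w (x i) ≤ 1)
    (hli : LinearIndependent (ResF v) fun i => resid w (x i)) {c : ι → K} {j : ι} (hj : j ∈ s)
    (hcj : c j ≠ 0) (hmax : ∀ i ∈ s, v (c i) ≤ v (c j)) :
    w (∑ i ∈ s, algebraMap K F (c i) * x i) = w (algebraMap K F (c j)) := by
  have hcj' : algebraMap K F (c j) ≠ 0 := by simpa using hcj
  have hvj : v (c j) ≠ 0 := by simpa using hcj
  have hle : ∀ i ∈ s, v (c i / c j) ≤ 1 := fun i hi => by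
    rw [map_div₀]; exact div_le_one_of_le₀ (hmax i hi) zero_le
  have hle' : ∀ i ∈ s, w (algebraMap K F (c i / c j)) ≤ 1 := fun i hi =>
    (Valuation.HasExtension.val_map_le_one_iff v w _).2 (hle i hi)
  have hle'' : ∀ i ∈ s, w (algebraMap K F (c i / c j) * x i) ≤ 1 := fun i hi => by
    rw [map_mul]; exact mul_le_one' (hle' i hi) (hx i)
  have hsum : ∑ i ∈ s, algebraMap K F (c i) * x i =
      algebraMap K F (c j) * ∑ i ∈ s, algebraMap K F (c i / c j) * x i := by
    rw [Finset.mul_sum]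
    refine Finset.sum_congr rfl fun i _ => ?_
    rw [map_div₀]; field_simp
  rw [hsum, map_mul]
  have h1 : w (∑ i ∈ s, algebraMap K F (c i / c j) * x i) = 1 := by
    apply val_eq_one_of_resid_ne_zero (w.map_sum_le hle'')
    rw [resid_sum _ _ hle'']
    intro h0
    have h2 : ∑ i ∈ s, resid v (c i / c j) • resid w (x i) = 0 := by
      rw [← h0]
      refine Finset.sum_congr rfl fun i hi => ?_
      rw [resid_mul (hle' i hi) (hx i), resid_algebraMap v w (hle i hi), Algebra.smul_def]
    have h3 := linearIndependent_iff'.1 hli s _ h2 j hj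
    rw [div_self hcj, resid_one] at h3
    exact one_ne_zero h3
  rw [h1, mul_one]

theorem exists_val_sum_eq {ι : Type*} {s : Finset ι} {x : ι → F} (hx : ∀ i, w (x i) ≤ 1)
    (hli : LinearIndependent (ResF v) fun i => resid w (x i)) {c : ι → K}
    (hc : ∃ i ∈ s, c i ≠ 0) :
    ∃ j ∈ s, c j ≠ 0 ∧ w (∑ i ∈ s, algebraMap K F (c i) * x i) = w (algebraMap K F (c j)) := by
  obtain ⟨i, hi, hci⟩ := hc
  obtain ⟨j, hj, hmax⟩ := s.exists_max_image (fun i => v (c i)) ⟨i, hi⟩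
  have hcj : c j ≠ 0 := by
    intro h
    have := hmax i hi
    rw [h, map_zero, le_zero_iff, map_eq_zero] at this
    exact hci this
  exact ⟨j, hj, hcj, val_sum_eq v w hx hli hj hcj hmax⟩

theorem linearIndependent_of_resid {ι : Type*} {x : ι → F} (hx : ∀ i, w (x i) ≤ 1)
    (hli : LinearIndependent (ResF v) fun i => resid w (x i)) : LinearIndependent K x := by
  rw [linearIndependent_iff']
  intro s c hs i hi
  by_contra hci
  obtain ⟨j, hj, hcj, h⟩ := exists_val_sum_eq v w hx hli ⟨i, hi, hci⟩
  simp only [Algebra.smul_def] at hs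
  rw [hs, map_zero, eq_comm, map_eq_zero, map_eq_zero] at h
  exact hcj h

theorem transcendental_iff_linearIndependent_pow {k E : Type*} [Field k] [Field E] [Algebra k E]
    {z : E} : Transcendental k z ↔ LinearIndependent k fun n : ℕ => z ^ n := by
  rw [transcendental_iff_injective]
  have h : (fun n : ℕ => z ^ n) = (aeval (R := k) z).toLinearMap ∘ basisMonomials k := by
    ext n; simp
  rw [h]
  constructor
  · intro hz
    exact (basisMonomials k).linearIndependent.map' _ (LinearMap.ker_eq_bot.2 hz)
  · intro hli
    rw [injective_iff_map_eq_zero]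
    intro p hp
    rw [← (basisMonomials k).linearCombination_repr p] at hp
    have hp' : (aeval (R := k) z).toLinearMap
      (Finsupp.linearCombination k (basisMonomials k) ((basisMonomials k).repr p)) = 0 := hp
    rw [Finsupp.apply_linearCombination] at hp'
    have := linearIndependent_iff.1 hli _ hp'
    simpa using this

variable {t : F} (ht : w t ≤ 1) (htr : Transcendental (ResF v) (resid w t))

include ht htr in
theorem transcendental_of_resid : Transcendental K t := by
  rw [transcendental_iff_linearIndependent_pow] at htr ⊢
  refine linearIndependent_of_resid v w (fun n => ?_) ?_
  · rw [map_pow]; exact pow_le_one' ht n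
  · simpa only [resid_pow ht] using htr

include ht htr in
theorem exists_val_aeval_eq {p : K[X]} (hp : p ≠ 0) :
    ∃ c : K, c ≠ 0 ∧ w (aeval t p) = w (algebraMap K F c) := by
  have h1 : ∃ i ∈ p.support, p.coeff i ≠ 0 :=
    ⟨p.natDegree, natDegree_mem_support_of_nonzero hp, by simpa using hp⟩
  rw [transcendental_iff_linearIndependent_pow] at htr
  obtain ⟨j, -, hj, h⟩ := exists_val_sum_eq v w (x := fun n : ℕ => t ^ n)
    (fun n => by rw [map_pow]; exact pow_le_one' ht n)
    (by simpa only [resid_pow ht] using htr) h1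
  refine ⟨_, hj, ?_⟩
  rw [aeval_eq_sum_range, ← h, ← sum_over_range' p (f := fun i a => a • t ^ i) (by simp) _
    (Nat.lt_succ_self _)]
  simp [Polynomial.sum, Algebra.smul_def]

omit [Algebra K F] in
theorem exists_val_eq_of_sum_eq_zero {ι : Type*} {s : Finset ι} (hs : s.Nonempty) {u : ι → F}
    (hu : ∀ i ∈ s, u i ≠ 0) (h0 : ∑ i ∈ s, u i = 0) :
    ∃ i ∈ s, ∃ j ∈ s, i ≠ j ∧ w (u i) = w (u j) := by
  classical
  obtain ⟨j, hj, hmax⟩ := s.exists_max_image (fun i => w (u i)) hs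
  by_contra! hne
  have hlt : w (∑ i ∈ s.erase j, u i) < w (u j) := by
    apply w.map_sum_lt (by simpa using hu j hj)
    intro i hi
    rw [Finset.mem_erase] at hi
    exact lt_of_le_of_ne (hmax i hi.2) (hne i hi.2 j hj hi.1)
  rw [← Finset.add_sum_erase s u hj] at h0
  rw [← Valuation.map_neg, ← eq_neg_of_add_eq_zero_left h0] at hlt
  exact lt_irrefl _ hlt

open IntermediateField.algebraAdjoinAdjoin

-- In an algebraic relation for `z` over `K[t]` two terms must share the same value, and nonzero
-- elements of `K[t]` have values of constants.
include ht htr in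
theorem exists_pow_val_eq (halg : Algebra.IsAlgebraic (IntermediateField.adjoin K {t}) F) {z : F}
    (hz : z ≠ 0) : ∃ n : ℕ, 0 < n ∧ ∃ c : K, c ≠ 0 ∧ w (z ^ n) = w (algebraMap K F c) := by
  have halg' : IsAlgebraic (Algebra.adjoin K {t}) z :=
    (IsFractionRing.isAlgebraic_iff (Algebra.adjoin K {t}) (IntermediateField.adjoin K {t}) F).2
      (halg.isAlgebraic z)
  obtain ⟨p, hp, hpz⟩ := halg'
  rw [aeval_eq_sum_range, ← sum_over_range' p (f := fun i a => a • z ^ i) (by simp) _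
    (Nat.lt_succ_self _), Polynomial.sum] at hpz
  have hco : ∀ i, p.coeff i ≠ 0 → ∃ c : K, c ≠ 0 ∧ w (p.coeff i : F) = w (algebraMap K F c) := by
    intro i hi
    obtain ⟨q, hq'⟩ := exists_aeval_eq_of_mem_adjoin_singleton (p.coeff i).2
    rw [← hq']
    refine exists_val_aeval_eq v w ht htr ?_
    rintro rfl
    rw [map_zero, eq_comm] at hq'
    exact hi (by exact_mod_cast hq')
  obtain ⟨i, hi, j, hj, hij, h⟩ := exists_val_eq_of_sum_eq_zero w
    (Polynomial.support_nonempty.2 hp) (u := fun i => p.coeff i • z ^ i) (fun i hi => by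
      rw [Algebra.smul_def]
      refine mul_ne_zero ?_ (pow_ne_zero _ hz)
      have := mem_support_iff.1 hi
      intro h
      exact this (Subtype.ext h)) hpz
  wlog hlt : i < j generalizing i j
  · exact this j hj i hi hij.symm h.symm (lt_of_le_of_ne (not_lt.1 hlt) hij.symm)
  obtain ⟨a, ha, hai⟩ := hco i (mem_support_iff.1 hi)
  obtain ⟨b, hb, hbj⟩ := hco j (mem_support_iff.1 hj)
  refine ⟨j - i, by omega, a / b, div_ne_zero ha hb, ?_⟩
  have hwa : w (algebraMap K F a) ≠ 0 := by simpa using ha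
  have hwb : w (algebraMap K F b) ≠ 0 := by simpa using hb
  have hwz : w z ≠ 0 := by simpa using hz
  have h' : w (algebraMap K F a) * w z ^ i = w (algebraMap K F b) * w z ^ j := by
    rw [← hai, ← hbj, ← map_pow, ← map_pow, ← map_mul, ← map_mul]
    exact h
  have hj' : j = (j - i) + i := by omega
  rw [map_pow, map_div₀, map_div₀]
  rw [hj', pow_add, ← mul_assoc] at h'
  rw [eq_div_iff hwb, mul_right_cancel₀ (pow_ne_zero i hwz) h', mul_comm]

-- The powers of the residue of `t` are independent over `L`, so their products with the `r i` are
-- independent over the residue field of `v`. Hence the `x i * t ^ n` are independent over `K`,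
-- which is independence of the `x i` over `K[t]`. This bounds the degree of `L` by `[F : K(t)]`.
include ht htr in
theorem linearIndependent_adjoin_of_resid {ι : Type*} {x : ι → F} (hx : ∀ i, w (x i) ≤ 1)
    {L : IntermediateField (ResF v) (ResF w)} [Algebra.IsAlgebraic (ResF v) L] {r : ι → L}
    (hr : ∀ i, resid w (x i) = r i) (hli : LinearIndependent (ResF v) r) :
    LinearIndependent (IntermediateField.adjoin K {t}) x := by
  have hZ : LinearIndependent L fun n : ℕ => resid w t ^ n :=
    transcendental_iff_linearIndependent_pow.1 (htr.extendScalars L)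
  have hprod := linearIndependent_smul hli hZ
  have hprod' : LinearIndependent K fun p : ι × ℕ => x p.1 * t ^ p.2 := by
    have hle : ∀ p : ι × ℕ, w (t ^ p.2) ≤ 1 := fun p => by
      rw [map_pow]; exact pow_le_one' ht _
    refine linearIndependent_of_resid v w (fun p => ?_) ?_
    · rw [map_mul]; exact mul_le_one' (hx _) (hle p)
    · convert hprod using 2 with p
      rw [resid_mul (hx _) (hle p), hr, resid_pow ht]; rfl
  rw [← LinearIndependent.iff_fractionRing (R := Algebra.adjoin K {t})]
  rw [linearIndependent_iff']
  intro s g hg i hi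
  have hex : ∀ i, ∃ q : K[X], aeval t q = (g i : F) := fun i =>
    exists_aeval_eq_of_mem_adjoin_singleton (g i).2
  choose q hq using hex
  obtain ⟨N, hN⟩ : ∃ N, ∀ i ∈ s, (q i).natDegree < N :=
    ⟨s.sup (fun i => (q i).natDegree) + 1, fun i hi =>
      Nat.lt_succ_of_le (Finset.le_sup (f := fun i => (q i).natDegree) hi)⟩
  have h0 : ∑ p ∈ s ×ˢ Finset.range N, (q p.1).coeff p.2 • (x p.1 * t ^ p.2) = 0 := by
    rw [Finset.sum_product, ← hg]
    refine Finset.sum_congr rfl fun i hi => ?_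
    rw [Algebra.smul_def]
    change _ = (g i : F) * x i
    rw [← hq, aeval_eq_sum_range' (hN i hi), Finset.sum_mul]
    refine Finset.sum_congr rfl fun j _ => ?_
    simp only [Algebra.smul_def]; ring
  have hcoef := linearIndependent_iff'.1 hprod' _ _ h0
  have hqi : q i = 0 := by
    ext j
    by_cases hj : j < N
    · simpa using hcoef (i, j) (by simp [hi, hj])
    · rw [coeff_zero]; exact coeff_eq_zero_of_natDegree_lt ((hN i hi).trans_le (not_lt.1 hj))
  have := hq i
  rw [hqi, map_zero, eq_comm] at this
  exact_mod_cast this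

include ht htr in
theorem finiteDimensional_of_isAlgebraic_resid
    [FiniteDimensional (IntermediateField.adjoin K {t}) F]
    (L : IntermediateField (ResF v) (ResF w)) [Algebra.IsAlgebraic (ResF v) L] :
    FiniteDimensional (ResF v) L := by
  refine finiteDimensional_of_card_le (n := Module.finrank (IntermediateField.adjoin K {t}) F)
    fun s hs => ?_
  choose x hx1 hx2 using fun i : s => exists_resid_eq (w := w) ((i : L) : ResF w)
  have hli := linearIndependent_adjoin_of_resid v w ht htr hx1 hx2 hs
  simpa using hli.fintype_card_le_finrank

end Gauss

/-! ### Finiteness of a function field over `K(t)`. -/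

section FunctionField

variable {K F : Type*} [Field K] [Field F] [Algebra K F]

theorem aeval_mem_adjoin_simple (x : F) (p : K[X]) :
    aeval x p ∈ IntermediateField.adjoin K {x} :=
  (IntermediateField.mem_adjoin_simple_iff K _).2 ⟨p, 1, by simp⟩

-- `F` has transcendence degree at most one, so any transcendental `t` is a transcendence basis and
-- the generators `x`, `y` are algebraic over `K(t)`.
open IntermediateField.algebraAdjoinAdjoin in
theorem finiteDimensional_adjoin_of_transcendental {x y t : F} {f : K[X]}
    (hxy : y ^ 2 = aeval x f) (htop : IntermediateField.adjoin K {x, y} = ⊤)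
    (ht : Transcendental K t) : FiniteDimensional (IntermediateField.adjoin K {t}) F := by
  have gen : ∀ z : F, IsAlgebraic (IntermediateField.adjoin K {z}) x →
      IsAlgebraic (IntermediateField.adjoin K {z}) y →
      FiniteDimensional (IntermediateField.adjoin K {z}) F := by
    intro z hx hy
    have hfin : FiniteDimensional (IntermediateField.adjoin K {z})
        (IntermediateField.adjoin (IntermediateField.adjoin K {z}) {x, y}) := by
      apply IntermediateField.finiteDimensional_adjoin
      rintro a (rfl | rfl)
      · exact hx.isIntegral
      · exact hy.isIntegral
    have : IntermediateField.adjoin (IntermediateField.adjoin K {z}) {x, y} = ⊤ := by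
      apply IntermediateField.restrictScalars_injective K
      rw [IntermediateField.restrictScalars_top, eq_top_iff, ← htop,
        IntermediateField.adjoin_le_iff]
      intro a ha
      rw [SetLike.mem_coe, IntermediateField.mem_restrictScalars]
      exact IntermediateField.subset_adjoin _ _ ha
    rw [this] at hfin
    exact Module.Finite.equiv
      (IntermediateField.topEquiv (F := IntermediateField.adjoin K {z}) (E := F)).toLinearEquiv
  have halgx : IsAlgebraic (IntermediateField.adjoin K {x}) x :=
    isAlgebraic_algebraMap (⟨x, IntermediateField.mem_adjoin_simple_self K x⟩ :
      IntermediateField.adjoin K {x})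
  have hfin : FiniteDimensional (IntermediateField.adjoin K {x}) F := by
    refine gen x halgx ?_
    have hmem : y ^ 2 ∈ IntermediateField.adjoin K {x} := by
      rw [hxy]
      exact aeval_mem_adjoin_simple x f
    exact IsAlgebraic.of_pow two_pos (isAlgebraic_algebraMap (⟨_, hmem⟩ :
      IntermediateField.adjoin K {x}))
  have halg : Algebra.IsAlgebraic (Algebra.adjoin K {x}) F :=
    (IsFractionRing.comap_isAlgebraic_iff (A := Algebra.adjoin K {x})
      (K := IntermediateField.adjoin K {x})).2 inferInstance
  have htrdeg : Algebra.trdeg K F ≤ 1 := by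
    simpa using Algebra.IsAlgebraic.trdeg_le_cardinalMk K ({x} : Set F)
  have hb : IsTranscendenceBasis K (fun _ : Unit => t) :=
    AlgebraicIndependent.isTranscendenceBasis_of_lift_trdeg_le_of_finite
      ((algebraicIndependent_unique_type_iff (ι := Unit)).2 ht) (by simpa using htrdeg)
  have halgt := hb.isAlgebraic_field
  rw [Set.range_const] at halgt
  exact gen t (halgt.isAlgebraic x) (halgt.isAlgebraic y)

end FunctionField

/-! ### Tame elements. -/

section Tame

variable {K F Γ₀ Γ : Type*} [Field K] [Field F] [Algebra K F]
  [LinearOrderedCommGroupWithZero Γ₀] [LinearOrderedCommGroupWithZero Γ]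
  (v : Valuation K Γ₀) (w : Valuation F Γ) [v.HasExtension w]

/-- An element is tame if some power of it is, up to a constant from the base field, a unit with
algebraic residue. -/
def IsTame (z : F) : Prop :=
  ∃ n : ℕ, 0 < n ∧ ∃ c : K, c ≠ 0 ∧ w (z ^ n / algebraMap K F c) = 1 ∧
    IsAlgebraic (ResF v) (resid w (z ^ n / algebraMap K F c))

variable {v w} {z z' : F}

theorem IsTame.ne_zero (h : IsTame v w z) : z ≠ 0 := by
  rintro rfl
  obtain ⟨n, hn, c, hc, h1, -⟩ := h
  simp [hn.ne'] at h1

theorem IsTame.of_isAlgebraic (h : w z = 1) (ha : IsAlgebraic (ResF v) (resid w z)) :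
    IsTame v w z :=
  ⟨1, one_pos, 1, one_ne_zero, by simpa using h, by simpa using ha⟩

theorem isTame_algebraMap {c : K} (hc : c ≠ 0) : IsTame v w (algebraMap K F c) := by
  have h : algebraMap K F c ^ 1 / algebraMap K F c = 1 := by
    rw [pow_one, div_self (by simpa using hc)]
  exact ⟨1, one_pos, c, hc, by rw [h, map_one], by rw [h, resid_one]; exact isAlgebraic_one⟩

theorem IsTame.mul (h : IsTame v w z) (h' : IsTame v w z') : IsTame v w (z * z') := by
  obtain ⟨n, hn, c, hc, h1, h2⟩ := h
  obtain ⟨m, hm, d, hd, h3, h4⟩ := h'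
  have key : (z * z') ^ (n * m) / algebraMap K F (c ^ m * d ^ n) =
      (z ^ n / algebraMap K F c) ^ m * (z' ^ m / algebraMap K F d) ^ n := by
    rw [mul_pow, map_mul, map_pow, map_pow, div_pow, div_pow, ← pow_mul, ← pow_mul,
      Nat.mul_comm m n, div_mul_div_comm]
  refine ⟨n * m, Nat.mul_pos hn hm, c ^ m * d ^ n, by positivity, ?_, ?_⟩
  · rw [key]; simp [h1, h3]
  · rw [key, resid_mul (by simp [h1]) (by simp [h3]), resid_pow h1.le, resid_pow h3.le]
    exact (h2.pow _).mul (h4.pow _)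

theorem IsTame.inv (h : IsTame v w z) : IsTame v w z⁻¹ := by
  obtain ⟨n, hn, c, hc, h1, h2⟩ := h
  have key : z⁻¹ ^ n / algebraMap K F c⁻¹ = (z ^ n / algebraMap K F c)⁻¹ := by
    rw [map_inv₀, inv_pow, inv_div_inv, inv_div]
  refine ⟨n, hn, c⁻¹, inv_ne_zero hc, ?_, ?_⟩
  · rw [key, map_inv₀, h1, inv_one]
  · rw [key, resid_inv h1]
    exact h2.inv

theorem IsTame.of_pow {m : ℕ} (hm : 0 < m) (h : IsTame v w (z ^ m)) : IsTame v w z := by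
  obtain ⟨n, hn, c, hc, h1, h2⟩ := h
  rw [← pow_mul] at h1 h2
  exact ⟨m * n, Nat.mul_pos hm hn, c, hc, h1, h2⟩

/-- When `z` is a unit, the constant `c` is a unit too, so `z ^ n` itself has algebraic residue. -/
theorem IsTame.isAlgebraic_resid (h : IsTame v w z) (hz : w z = 1) :
    IsAlgebraic (ResF v) (resid w z) := by
  obtain ⟨n, hn, c, hc, h1, h2⟩ := h
  have hc' : algebraMap K F c ≠ 0 := by simpa using hc
  have hwc : w (algebraMap K F c) = 1 := by
    rw [map_div₀, map_pow, hz, one_pow, one_div, inv_eq_one] at h1; exact h1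
  have hvc : v c ≤ 1 := ((Valuation.HasExtension.val_map_eq_one_iff v w c).1 hwc).le
  have h3 : z ^ n = z ^ n / algebraMap K F c * algebraMap K F c := by field_simp
  apply IsAlgebraic.of_pow hn
  rw [← resid_pow hz.le, h3, resid_mul h1.le hwc.le, resid_algebraMap v w hvc]
  exact h2.mul (isAlgebraic_algebraMap _)

variable (v w) in
/-- The monoid of tame elements. -/
def tameMonoid : Submonoid F where
  carrier := {z | IsTame v w z}
  mul_mem' := IsTame.mul
  one_mem' := by
    have := isTame_algebraMap (v := v) (w := w) (one_ne_zero (α := K))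
    rwa [map_one] at this

theorem IsTame.of_sub_one_lt (h : w (z - 1) < 1) : IsTame v w z := by
  have h1 : resid w z = 1 := by
    rw [resid_eq_of_sub_lt (y := 1) (by simp) h, resid_one]
  have hz : w z ≤ 1 := by
    have := w.map_add_le h.le (y := 1) (by simp)
    simpa using this
  exact .of_isAlgebraic (val_eq_one_of_resid_ne_zero hz (by simp [h1]))
    (by rw [h1]; exact isAlgebraic_one)

end Tame

/-! ### Residues of `K(x)` through `Q`-adic expansions. -/

section NormalForm

/-- `Z` stays transcendental over the algebraic closure of `k` in `E`, and the sum is a polynomial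
in `Z` with constant coefficient `c j ≠ 0`. -/
theorem sum_mul_pow_ne_zero {k E ι : Type*} [Field k] [Field E] [Algebra k E] {Z : E}
    (hZ : Transcendental k Z) {s : Finset ι} {c : ι → E} {m : ι → ℕ} {j : ι} (hj : j ∈ s)
    (hcj : c j ≠ 0) (hmj : m j = 0) (hm : ∀ i ∈ s, i ≠ j → 0 < m i)
    (hc : ∀ i ∈ s, IsAlgebraic k (c i)) : ∑ i ∈ s, c i * Z ^ m i ≠ 0 := by
  classical
  intro h0
  have hZ' : Transcendental (algebraicClosure k E) Z := hZ.algebraicClosure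
  let d : ι → algebraicClosure k E := fun i =>
    if h : i ∈ s then ⟨c i, mem_algebraicClosure_iff.2 (hc i h)⟩ else 0
  have hd : ∀ i ∈ s, (d i : E) = c i := fun i hi => by simp [d, hi]
  let p : (algebraicClosure k E)[X] := ∑ i ∈ s, C (d i) * X ^ m i
  have hp : aeval Z p = 0 := by
    rw [← h0]
    simp only [p, map_sum, map_mul, map_pow, aeval_X, aeval_C]
    exact Finset.sum_congr rfl fun i hi => by rw [← hd i hi]; rfl
  have hp0 : p = 0 := by
    by_contra hne
    exact hZ' ⟨p, hne, hp⟩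
  have h2 : p.coeff 0 = d j := by
    simp only [p, finsetSum_coeff, coeff_C_mul, coeff_X_pow]
    rw [Finset.sum_eq_single_of_mem j hj]
    · simp [hmj]
    · intro i hi hij
      rw [if_neg (hm i hi hij).ne, mul_zero]
  rw [hp0, coeff_zero] at h2
  apply hcj
  rw [← hd j hj, ← h2]; rfl

theorem exists_adic_expansion {K : Type*} [Field K] {Q : K[X]} (hQ : 0 < Q.natDegree) (P : K[X]) :
    ∃ (N : ℕ) (S : ℕ → K[X]), (∀ i, (S i).degree < Q.degree) ∧
      P = ∑ i ∈ Finset.range N, S i * Q ^ i := by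
  have hQ0 : Q ≠ 0 := by rintro rfl; simp at hQ
  induction hn : P.natDegree using Nat.strong_induction_on generalizing P with
  | _ n ih =>
    by_cases hd : P.degree < Q.degree
    · exact ⟨1, fun _ => P, fun _ => hd, by simp⟩
    have hP0 : P ≠ 0 := by
      rintro rfl
      exact hd (by rw [degree_zero]; exact bot_lt_iff_ne_bot.2 (degree_ne_bot.2 hQ0))
    have hlt : (P / Q).natDegree < n := by
      rw [← hn]
      by_cases h0 : P / Q = 0
      · rw [h0, natDegree_zero]
        exact hQ.trans_le (natDegree_le_natDegree (not_lt.1 hd))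
      · exact natDegree_lt_natDegree h0 (degree_div_lt hP0 (natDegree_pos_iff_degree_pos.1 hQ))
    obtain ⟨N, S, hS, hPQ⟩ := ih _ hlt (P / Q) rfl
    refine ⟨N + 1, fun i => Nat.casesOn i (P % Q) S, ?_, ?_⟩
    · rintro (_ | i)
      · exact EuclideanDomain.mod_lt P hQ0
      · exact hS i
    · rw [Finset.sum_range_succ']
      conv_lhs => rw [← EuclideanDomain.div_add_mod P Q, hPQ, Finset.mul_sum]
      simp only [pow_zero, mul_one]
      congr 1
      exact Finset.sum_congr rfl fun i _ => by ring

variable {K F Γ₀ Γ : Type*} [Field K] [Field F] [Algebra K F]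
  [LinearOrderedCommGroupWithZero Γ₀] [LinearOrderedCommGroupWithZero Γ]
  {v : Valuation K Γ₀} {w : Valuation F Γ} [v.HasExtension w]

variable (w) in
/-- The data describing the residues of the elements of a rational function field `K(x)`: a group
`G` of elements containing the values at `x` of all nonzero polynomials of degree less than that of
`Q`, and an element `s` of `G` which has the value of the least possible power `q ^ e` of
`q = Q(x)`. -/
structure ResidueFrame (x : F) (Q : K[X]) (G : Submonoid F) (e : ℕ) (s : F) : Prop where
  inv_closed : ∀ g ∈ G, g⁻¹ ∈ G
  ne_zero : ∀ g ∈ G, g ≠ 0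
  natDegree_pos : 0 < Q.natDegree
  aeval_mem : ∀ S : K[X], S ≠ 0 → S.degree < Q.degree → aeval x S ∈ G
  pos : 0 < e
  val_ne : ∀ r, 0 < r → r < e → ∀ g ∈ G, w (aeval x Q ^ r) ≠ w g
  mem : s ∈ G
  val_eq : w (aeval x Q ^ e) = w s

namespace ResidueFrame

variable {x : F} {Q : K[X]} {G : Submonoid F} {e : ℕ} {s : F} (H : ResidueFrame w x Q G e s)

include H

theorem zpow_closed {g : F} (hg : g ∈ G) (n : ℤ) : g ^ n ∈ G := by
  cases n with
  | ofNat n => simpa using pow_mem hg n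
  | negSucc n => rw [zpow_negSucc]; exact H.inv_closed _ (pow_mem hg _)

theorem aeval_ne_zero : aeval x Q ≠ 0 := by
  intro h
  have := H.val_eq
  rw [h, zero_pow H.pos.ne', map_zero, eq_comm, map_eq_zero] at this
  exact H.ne_zero _ H.mem this

theorem val_div : w (aeval x Q ^ e / s) = 1 := by
  have := H.ne_zero _ H.mem
  rw [map_div₀, H.val_eq, div_self (by simpa using this)]

/-- Divide `n` by `e`: a nonzero remainder `r < e` would give `q ^ r` the value of an element of
`G`, against the minimality of `e`. -/
theorem exists_eq_of_val_eq {g : F} (hg : g ∈ G) {n : ℤ} (h : w (g * aeval x Q ^ n) = 1) :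
    ∃ m : ℤ, n = e * m ∧ ∃ g' ∈ G, w g' = 1 ∧
      g * aeval x Q ^ n = g' * (aeval x Q ^ e / s) ^ m := by
  have hq := H.aeval_ne_zero
  have hs := H.ne_zero _ H.mem
  have he : (0 : ℤ) < e := by exact_mod_cast H.pos
  have hr0 := Int.emod_nonneg n he.ne'
  have hre := Int.emod_lt_of_pos n he
  have hdiv := Int.mul_ediv_add_emod n e
  set m := n / (e : ℤ)
  obtain ⟨r, hr⟩ := Int.eq_ofNat_of_zero_le hr0
  rw [hr] at hre hdiv
  have key : g * aeval x Q ^ n = g * s ^ m * (aeval x Q ^ e / s) ^ m * aeval x Q ^ r := by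
    rw [← hdiv, zpow_add₀ hq, zpow_mul, div_zpow, zpow_natCast, zpow_natCast]
    have := zpow_ne_zero m hs
    field_simp
  have hmem : g * s ^ m ∈ G := mul_mem hg (H.zpow_closed H.mem m)
  rw [key, map_mul, map_mul, map_zpow₀, H.val_div, one_zpow, mul_one] at h
  rcases Nat.eq_zero_or_pos r with rfl | hrpos
  · refine ⟨m, by simpa using hdiv.symm, _, hmem, by simpa using h, ?_⟩
    rw [key]; simp
  · refine absurd ?_ (H.val_ne r hrpos (by exact_mod_cast hre) _ (H.inv_closed _ hmem))
    rw [map_inv₀]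
    exact eq_inv_of_mul_eq_one_right h

variable (M : IntermediateField (ResF v) (ResF w))
  (hGM : ∀ g ∈ G, w g = 1 → resid w g ∈ M ∧ IsAlgebraic (ResF v) (resid w g))
  (hZ : Transcendental (ResF v) (resid w (aeval x Q ^ e / s)))
  (hZM : resid w (aeval x Q ^ e / s) ∈ M)

include hGM hZ hZM

theorem exists_normal_form_aeval {P : K[X]} (hP : P ≠ 0) :
    ∃ g ∈ G, ∃ m : ℕ, ∃ p, aeval x P = g * aeval x Q ^ m * p ∧ w p = 1 ∧ resid w p ∈ M := by
  classical
  obtain ⟨N, S, hS, hPS⟩ := exists_adic_expansion H.natDegree_pos P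
  have hq := H.aeval_ne_zero
  set q := aeval x Q with hqdef
  set Z := resid w (q ^ e / s)
  set I := (Finset.range N).filter fun i => S i ≠ 0
  let u : ℕ → F := fun i => aeval x (S i) * q ^ i
  have hSG : ∀ i ∈ I, aeval x (S i) ∈ G := fun i hi =>
    H.aeval_mem _ (Finset.mem_filter.1 hi).2 (hS i)
  have hPu : aeval x P = ∑ i ∈ I, u i := by
    rw [hPS, map_sum, Finset.sum_filter]
    refine Finset.sum_congr rfl fun i _ => ?_
    by_cases h : S i = 0 <;> simp [h, u, hqdef]
  have hIne : I.Nonempty := by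
    rw [Finset.nonempty_iff_ne_empty]
    intro hI
    apply hP
    rw [hPS]
    refine Finset.sum_eq_zero fun i hi => ?_
    have : i ∉ I := by simp [hI]
    have : S i = 0 := by simpa [I, Finset.mem_range.1 hi] using this
    rw [this, zero_mul]
  have hu0 : ∀ i ∈ I, u i ≠ 0 := fun i hi =>
    mul_ne_zero (H.ne_zero _ (hSG i hi)) (pow_ne_zero _ hq)
  obtain ⟨j₀, hj₀, hmax⟩ := I.exists_max_image (fun i => w (u i)) hIne
  -- Normalise by the dominant term of least index `j`. Every other dominant term then contributes a
  -- positive power of `Z`, so the residue of the normalised sum is a polynomial in `Z` with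
  -- constant term `1`.
  set J := I.filter fun i => w (u i) = w (u j₀)
  have hJne : J.Nonempty := ⟨j₀, by simp [J, hj₀]⟩
  set j := J.min' hJne
  have hjJ : j ∈ J := J.min'_mem hJne
  have hjI : j ∈ I := (Finset.mem_filter.1 hjJ).1
  have hwj : w (u j) = w (u j₀) := (Finset.mem_filter.1 hjJ).2
  have hwj0 : w (u j) ≠ 0 := by simpa using hu0 j hjI
  have hτ : ∀ i ∈ I, w (u i / u j) ≤ 1 := fun i hi => by
    rw [map_div₀]
    exact div_le_one_of_le₀ (hwj ▸ hmax i hi) zero_le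
  have hform : ∀ i ∈ I, ∃ c : ResF w, ∃ m : ℕ, c ∈ M ∧ IsAlgebraic (ResF v) c ∧
      resid w (u i / u j) = c * Z ^ m ∧ (i = j → c = 1 ∧ m = 0) ∧ (i ≠ j → 0 < m) := by
    intro i hi
    by_cases hij : i = j
    · refine ⟨1, 0, one_mem _, isAlgebraic_one, ?_, by simp, fun h => absurd hij h⟩
      rw [hij, div_self (hu0 j hjI)]; simp
    by_cases hiJ : w (u i / u j) = 1
    · have hiJ' : i ∈ J := by
        rw [map_div₀, div_eq_one_iff_eq hwj0] at hiJ
        exact Finset.mem_filter.2 ⟨hi, hiJ.trans hwj⟩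
      have hlt : j < i := lt_of_le_of_ne (J.min'_le i hiJ') (Ne.symm hij)
      have hSj0 := H.ne_zero _ (hSG j hjI)
      have hτi : u i / u j = aeval x (S i) * (aeval x (S j))⁻¹ * q ^ ((i : ℤ) - j) := by
        rw [zpow_sub₀ hq, zpow_natCast, zpow_natCast]
        simp only [u]
        field_simp
      rw [hτi] at hiJ ⊢
      obtain ⟨m, hm, g, hg, hwg, hgm⟩ := H.exists_eq_of_val_eq
        (mul_mem (hSG i hi) (H.inv_closed _ (hSG j hjI))) hiJ
      have hmpos : 0 < m := by
        have h1 : (0 : ℤ) < e * m := by rw [← hm]; omega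
        exact pos_of_mul_pos_right h1 (by positivity)
      lift m to ℕ using hmpos.le
      obtain ⟨h1, h2⟩ := hGM g hg hwg
      refine ⟨resid w g, m, h1, h2, ?_, fun h => absurd h hij, fun _ => by exact_mod_cast hmpos⟩
      rw [hgm, zpow_natCast, resid_mul hwg.le (by simp [H.val_div]),
        resid_pow H.val_div.le]
    -- A non-dominant term has residue `0`, recorded as `0 * Z ^ 1` to keep its exponent positive.
    · refine ⟨0, 1, zero_mem _, isAlgebraic_zero, ?_, fun h => absurd h hij, fun _ => one_pos⟩
      rw [resid_eq_zero (lt_of_le_of_ne (hτ i hi) hiJ), zero_mul]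
  choose! c m hcM hcalg hcm hcj hmi using hform
  have hsum : resid w (∑ i ∈ I, u i / u j) = ∑ i ∈ I, c i * Z ^ m i := by
    rw [resid_sum _ _ hτ]
    exact Finset.sum_congr rfl hcm
  have hne : ∑ i ∈ I, c i * Z ^ m i ≠ 0 :=
    sum_mul_pow_ne_zero hZ hjI (by rw [(hcj j hjI rfl).1]; exact one_ne_zero) (hcj j hjI rfl).2
      hmi hcalg
  refine ⟨aeval x (S j), hSG j hjI, j, ∑ i ∈ I, u i / u j, ?_, ?_, ?_⟩
  · rw [hPu, ← Finset.sum_div]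
    exact (mul_div_cancel₀ _ (hu0 j hjI)).symm
  · exact val_eq_one_of_resid_ne_zero (w.map_sum_le hτ) (hsum ▸ hne)
  · rw [hsum]
    exact sum_mem fun i hi => mul_mem (hcM i hi) (pow_mem hZM _)

theorem exists_normal_form {z : F} (hz : z ∈ IntermediateField.adjoin K {x}) (hz0 : z ≠ 0) :
    ∃ g ∈ G, ∃ m : ℤ, ∃ p, z = g * aeval x Q ^ m * p ∧ w p = 1 ∧ resid w p ∈ M := by
  obtain ⟨A, B, rfl⟩ := (IntermediateField.mem_adjoin_simple_iff K _).1 hz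
  have hA : A ≠ 0 := by rintro rfl; simp at hz0
  have hB : B ≠ 0 := by rintro rfl; simp at hz0
  obtain ⟨g, hg, m, p, h1, h2, h3⟩ := H.exists_normal_form_aeval M hGM hZ hZM hA
  obtain ⟨g', hg', m', p', h1', h2', h3'⟩ := H.exists_normal_form_aeval M hGM hZ hZM hB
  refine ⟨g * g'⁻¹, mul_mem hg (H.inv_closed _ hg'), m - m', p / p', ?_, by simp [h2, h2'], ?_⟩
  · rw [h1, h1', zpow_sub₀ H.aeval_ne_zero, zpow_natCast, zpow_natCast]
    rw [div_eq_mul_inv, div_eq_mul_inv, div_eq_mul_inv, mul_inv, mul_inv]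
    ring
  · rw [div_eq_mul_inv, resid_mul h2.le (by simp [h2']), resid_inv h2']
    exact mul_mem h3 (inv_mem h3')

theorem resid_mem {z : F} (hz : z ∈ IntermediateField.adjoin K {x}) (hw : w z ≤ 1) :
    resid w z ∈ M := by
  rcases hw.lt_or_eq with hlt | heq
  · rw [resid_eq_zero hlt]; exact zero_mem _
  have hz0 : z ≠ 0 := by rintro rfl; simp at heq
  obtain ⟨g, hg, m, p, rfl, h2, h3⟩ := H.exists_normal_form M hGM hZ hZM hz hz0
  rw [map_mul, h2, mul_one] at heq
  obtain ⟨n, -, g', hg', hwg', h⟩ := H.exists_eq_of_val_eq hg heq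
  rw [resid_mul heq.le h2.le, h, resid_mul hwg'.le (by simp [H.val_div]), resid_zpow H.val_div]
  exact mul_mem (mul_mem (hGM g' hg' hwg').1 (zpow_mem hZM n)) h3

end ResidueFrame

end NormalForm

/-! ### The residue field of a quadratic extension. -/

section QuadraticExtension

variable {K F Γ₀ Γ : Type*} [Field K] [Field F] [Algebra K F]
  [LinearOrderedCommGroupWithZero Γ₀] [LinearOrderedCommGroupWithZero Γ]
  {v : Valuation K Γ₀} {w : Valuation F Γ} [v.HasExtension w]
  {E : IntermediateField K F} {y : F}
  (hE : ∀ z : F, ∃ a ∈ E, ∃ b ∈ E, z = a + b * y)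
  (M : IntermediateField (ResF v) (ResF w)) (hM : ∀ a ∈ E, w a ≤ 1 → resid w a ∈ M)

include hE hM

/-- The values of `a` and `b * y` never agree unless `b * y = 0`, so an integral element has the
residue of its component `a`. -/
theorem eq_top_of_forall_val_ne_one (hy : ¬ ∃ ψ ∈ E, w (ψ * y) = 1) : M = ⊤ := by
  rw [eq_top_iff]
  rintro r -
  obtain ⟨z, hz, rfl⟩ := exists_resid_eq r
  obtain ⟨a, ha, b, hb, rfl⟩ := hE z
  by_cases hby : b * y = 0
  · rw [hby, add_zero] at hz ⊢
    exact hM a ha hz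
  have hne : w a ≠ w (b * y) := by
    intro h
    have ha0 : w a ≠ 0 := by rw [h]; simpa using hby
    refine hy ⟨b / a, div_mem hb ha, ?_⟩
    rw [div_mul_eq_mul_div, map_div₀, ← h, div_self ha0]
  have hmax := w.map_add_of_distinct_val hne
  rw [hmax, max_le_iff] at hz
  have hlt : w (b * y) < 1 := lt_of_le_of_ne hz.2 fun h => hy ⟨b, hb, h⟩
  rw [resid_add hz.1 hz.2, resid_eq_zero hlt, add_zero]
  exact hM a ha hz.1

theorem eq_top_of_resid_mem (h2 : w 2 = 1) (harch : ∀ a b : F, w a < 1 → ∃ n, w (a ^ n * b) < 1)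
    (hyE : y ^ 2 ∈ E) (hy : w y = 1) (hyM : resid w y ∈ M) : M = ⊤ := by
  rw [eq_top_iff]
  rintro r -
  obtain ⟨z, hz, rfl⟩ := exists_resid_eq r
  obtain ⟨a, ha, b, hb, rfl⟩ := hE z
  -- Either `y` is residually close to `E`, and then it is a limit of elements of `E`, or `w (a + b
  -- * y)` is the maximum of `w a` and `w b`.
  by_cases happ : ∃ α ∈ E, w (y - α) < 1
  · obtain ⟨α, hα, hyα⟩ := happ
    -- Newton's iteration for the square root of `y ^ 2`; since `2` is a unit, the error is squared
    -- at each step.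
    have newton : ∀ n : ℕ, ∃ β ∈ E, w (y - β) ≤ w (y - α) ^ (n + 1) := by
      intro n
      induction n with
      | zero => exact ⟨α, hα, by simp⟩
      | succ n ih =>
        obtain ⟨β, hβ, h⟩ := ih
        have hlt : w (y - β) < 1 := h.trans_lt (pow_lt_one₀ zero_le hyα (by omega))
        have hwβ : w β = 1 := by
          rw [← hy]
          exact (w.map_eq_of_sub_lt (by rw [hy, Valuation.map_sub_swap]; exact hlt))
        have hβ0 : β ≠ 0 := by rintro rfl; simp at hwβ
        have h20 : (2 : F) ≠ 0 := by intro h; rw [h, map_zero] at h2; exact zero_ne_one h2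
        refine ⟨(β + y ^ 2 / β) / 2, div_mem (add_mem hβ (div_mem hyE hβ))
          (by exact_mod_cast E.natCast_mem 2), ?_⟩
        have heq : y - (β + y ^ 2 / β) / 2 = -((y - β) ^ 2 / (2 * β)) := by
          field_simp; ring
        rw [heq, Valuation.map_neg, map_div₀, map_mul, h2, hwβ, mul_one, div_one, map_pow]
        calc w (y - β) ^ 2 ≤ (w (y - α) ^ (n + 1)) ^ 2 := pow_le_pow_left₀ zero_le h 2
          _ ≤ w (y - α) ^ (n + 1 + 1) := by
            rw [← pow_mul]
            exact pow_le_pow_of_le_one zero_le hyα.le (by omega)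
    -- The archimedean property makes the error smaller than `1` even after multiplication by `b`.
    obtain ⟨n, hn⟩ := harch _ b hyα
    obtain ⟨β, hβ, h⟩ := newton n
    have hlt : w (a + b * y - (a + b * β)) < 1 := by
      have : a + b * y - (a + b * β) = (y - β) * b := by ring
      rw [this, map_mul]
      refine lt_of_le_of_lt ?_ hn
      rw [map_mul, map_pow]
      refine mul_le_mul_left (h.trans ?_) _
      exact pow_le_pow_of_le_one zero_le hyα.le (by omega)
    have hle : w (a + b * β) ≤ 1 := by
      have := w.map_sub_le hz hlt.le
      rwa [sub_sub_cancel] at this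
    rw [resid_eq_of_sub_lt hle hlt]
    exact hM _ (add_mem ha (mul_mem hb hβ)) hle
  · have hle : w a ≤ 1 ∧ w b ≤ 1 := by
      have hwb : w (b * y) = w b := by rw [map_mul, hy, mul_one]
      by_cases hab : w a = w b
      · by_cases hb0 : b = 0
        · rw [hab, hb0]; simp
        · have hwb0 : w b ≠ 0 := by simpa using hb0
          have : w (a + b * y) = w b := by
            have h1 : a + b * y = b * (y - -(a / b)) := by field_simp; ring
            have h3 : w (y - -(a / b)) ≤ 1 :=
              w.map_sub_le hy.le (by rw [Valuation.map_neg, map_div₀, hab, div_self hwb0])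
            have h4 : w (y - -(a / b)) = 1 := le_antisymm h3
              (not_lt.1 fun h => happ ⟨_, neg_mem (div_mem ha hb), h⟩)
            rw [h1, map_mul, h4, mul_one]
          rw [hab, ← this]; exact ⟨hz, hz⟩
      · rw [w.map_add_of_distinct_val (by rwa [hwb]), hwb, max_le_iff] at hz
        exact hz
    rw [resid_add hle.1 (by rw [map_mul, hy, mul_one]; exact hle.2), resid_mul hle.2 hy.le]
    exact add_mem (hM a ha hle.1) (mul_mem (hM b hb hle.2) hyM)

end QuadraticExtension

/-! ### Archimedean values, Hensel's lemma for squares, sums of two squares. -/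

section Preliminaries

variable {K F Γ₀ Γ : Type*} [Field K] [Field F] [Algebra K F]
  [LinearOrderedCommGroupWithZero Γ₀] [LinearOrderedCommGroupWithZero Γ]

/-- Up to powers, all nonzero values of `w` come from `K`, so the archimedean property of `v` passes
to `w`. -/
theorem exists_val_pow_mul_lt_one [MulArchimedean Γ₀] (v : Valuation K Γ₀) (w : Valuation F Γ)
    [v.HasExtension w]
    (hrat : ∀ z : F, z ≠ 0 → ∃ n : ℕ, 0 < n ∧ ∃ c : K, c ≠ 0 ∧ w (z ^ n) = w (algebraMap K F c))
    (a b : F) (ha : w a < 1) : ∃ n, w (a ^ n * b) < 1 := by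
  by_cases hb1 : w b ≤ 1
  · exact ⟨1, by rw [pow_one, map_mul]; exact mul_lt_one_of_lt_of_le ha hb1⟩
  have hb0 : b ≠ 0 := by rintro rfl; simp at hb1
  by_cases ha0 : a = 0
  · exact ⟨1, by simp [ha0]⟩
  obtain ⟨p, hp, c, hc, hac⟩ := hrat a ha0
  obtain ⟨q, hq, d, hd, hbd⟩ := hrat b hb0
  have hvc : v c < 1 := by
    rw [← Valuation.HasExtension.val_map_lt_one_iff v w, ← hac, map_pow]
    exact pow_lt_one₀ zero_le ha hp.ne'
  have hvc0 : v c ≠ 0 := by simpa using hc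
  obtain ⟨n, hn⟩ := MulArchimedean.arch (v d) ((one_lt_inv₀ (zero_lt_iff.2 hvc0)).2 hvc)
  have hlt : v (c ^ (n + 1) * d) < 1 := by
    rw [map_mul, map_pow, pow_succ]
    have h1 : v c ^ n * v d ≤ 1 := by
      calc v c ^ n * v d ≤ v c ^ n * (v c)⁻¹ ^ n := mul_le_mul_right hn _
        _ = 1 := by rw [← mul_pow, mul_inv_cancel₀ hvc0, one_pow]
    calc v c ^ n * v c * v d = v c * (v c ^ n * v d) := by rw [mul_comm (v c ^ n), mul_assoc]
      _ < 1 := mul_lt_one_of_lt_of_le hvc h1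
  rw [← Valuation.HasExtension.val_map_lt_one_iff v w, map_mul, map_mul, map_pow, map_pow, ← hac,
    ← hbd] at hlt
  refine ⟨p * (n + 1), lt_of_le_of_lt ?_ hlt⟩
  rw [map_mul, map_pow, map_pow, map_pow, pow_mul]
  exact mul_le_mul_right (le_self_pow (not_le.1 hb1).le hq.ne') _

theorem exists_eq_sq_of_resid_eq_sq (v : Valuation K Γ₀)
    (hhens : HenselianLocalRing v.valuationSubring) (h2 : (2 : ResF v) ≠ 0) {u : K} (hu : v u = 1)
    {δ : ResF v} (hδ : resid v u = δ ^ 2) : ∃ η, u = η ^ 2 := by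
  obtain ⟨a, rfl⟩ := IsLocalRing.residue_surjective δ
  rw [resid_of_le hu.le] at hδ
  obtain ⟨η, hη, -⟩ := HenselianLocalRing.is_henselian
    (X ^ 2 - C (⟨u, hu.le⟩ : v.valuationSubring)) (monic_X_pow_sub_C _ two_ne_zero) a
    (by
      rw [← IsLocalRing.residue_eq_zero_iff]
      simp [hδ])
    (by
      rw [← IsLocalRing.residue_ne_zero_iff_isUnit]
      have ha : IsLocalRing.residue v.valuationSubring a ≠ 0 := by
        intro h0
        rw [h0, zero_pow two_ne_zero, ← resid_of_le hu.le] at hδ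
        exact resid_ne_zero hu hδ
      have h2' : (1 + 1 : ResF v) ≠ 0 := by rwa [one_add_one_eq_two]
      simpa using ⟨h2', (IsLocalRing.residue_ne_zero_iff_isUnit _).1 ha⟩)
  refine ⟨η, ?_⟩
  have h := congrArg (fun z : v.valuationSubring => (z : K)) hη
  simp only [eval_sub, eval_pow, eval_X, eval_C] at h
  have h' : (η : K) ^ 2 - u = 0 := h
  linear_combination -h'

/-- If the residues of the two squares cancelled, their quotient would give a square root of `-1`.
-/
theorem val_add_sq_eq_one {w : Valuation F Γ} (hi : ¬ ∃ i : ResF w, i ^ 2 = -1) {a b : F}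
    (ha : w a ≤ 1) (hb : w b ≤ 1) (h : resid w a ≠ 0 ∨ resid w b ≠ 0) :
    w (a ^ 2 + b ^ 2) = 1 ∧ resid w (a ^ 2 + b ^ 2) = resid w a ^ 2 + resid w b ^ 2 := by
  have ha' : w (a ^ 2) ≤ 1 := by rw [map_pow]; exact pow_le_one' ha 2
  have hb' : w (b ^ 2) ≤ 1 := by rw [map_pow]; exact pow_le_one' hb 2
  have hres : resid w (a ^ 2 + b ^ 2) = resid w a ^ 2 + resid w b ^ 2 := by
    rw [resid_add ha' hb', resid_pow ha, resid_pow hb]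
  refine ⟨val_eq_one_of_resid_ne_zero (w.map_add_le ha' hb') ?_, hres⟩
  rw [hres]
  intro h0
  by_cases hb0 : resid w b = 0
  · rw [hb0, zero_pow two_ne_zero, add_zero, sq_eq_zero_iff] at h0
    exact h.elim (fun h => h h0) fun h => h hb0
  · refine hi ⟨resid w a / resid w b, ?_⟩
    rw [div_pow, eq_neg_of_add_eq_zero_left h0]
    field_simp

end Preliminaries

/-! ### The ruled case: `y²` is tame. -/

section TameCase

variable {K F Γ₀ Γ : Type*} [Field K] [Field F] [Algebra K F]
  [LinearOrderedCommGroupWithZero Γ₀] [LinearOrderedCommGroupWithZero Γ]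
  {v : Valuation K Γ₀} {w : Valuation F Γ} [v.HasExtension w]

theorem exists_eq_add_mul_mul {E : IntermediateField K F} {y : F}
    (hE : ∀ z : F, ∃ a ∈ E, ∃ b ∈ E, z = a + b * y) {ψ : F} (hψ : ψ ∈ E) (hψ0 : ψ ≠ 0) (z : F) :
    ∃ a ∈ E, ∃ b ∈ E, z = a + b * (ψ * y) := by
  obtain ⟨a, ha, b, hb, rfl⟩ := hE z
  exact ⟨a, ha, b / ψ, div_mem hb hψ, by field_simp⟩

/-- If `F = K(x)(y)` with `y ^ 2` tame in `K(x)`, then the residue field extension is ruled. -/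
theorem isRuledExtension_of_isTame {x y : F} (hx : Transcendental K x)
    (hE : ∀ z : F, ∃ a ∈ IntermediateField.adjoin K {x},
      ∃ b ∈ IntermediateField.adjoin K {x}, z = a + b * y)
    (hrat : ∀ z : F, z ≠ 0 → ∃ n : ℕ, 0 < n ∧ ∃ c : K, c ≠ 0 ∧ w (z ^ n) = w (algebraMap K F c))
    (h2 : w 2 = 1) (harch : ∀ a b : F, w a < 1 → ∃ n, w (a ^ n * b) < 1)
    [FiniteDimensional (ResF v) (algebraicClosure (ResF v) (ResF w))]
    (htr : ∃ r : ResF w, Transcendental (ResF v) r)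
    (hyE : y ^ 2 ∈ IntermediateField.adjoin K {x}) (hy : IsTame v w (y ^ 2)) :
    IsRuledExtension (ResF v) (ResF w) := by
  set E := IntermediateField.adjoin K {x} with hEdef
  set L := algebraicClosure (ResF v) (ResF w)
  have hx0 : ∀ P : K[X], P ≠ 0 → aeval x P ≠ 0 := fun P hP h => hx ⟨P, hP, h⟩
  have hytame : IsTame v w y := hy.of_pow two_pos
  have hsq : ∀ ψ ∈ E, (ψ * y) ^ 2 ∈ E := fun ψ hψ => by
    rw [mul_pow]; exact mul_mem (pow_mem hψ 2) hyE
  -- If all nonzero polynomials were tame at `x`, every residue of `w` would be algebraic.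
  have hex : ∃ n : ℕ, ∃ Q : K[X], Q ≠ 0 ∧ ¬ IsTame v w (aeval x Q) ∧ Q.natDegree = n := by
    by_contra! hall
    have hall' : ∀ Q : K[X], Q ≠ 0 → IsTame v w (aeval x Q) := fun Q hQ => by
      by_contra h
      exact hall _ Q hQ h rfl
    have htame : ∀ a ∈ E, a ≠ 0 → IsTame v w a := by
      intro a ha ha0
      obtain ⟨P, R, rfl⟩ := (IntermediateField.mem_adjoin_simple_iff K _).1 ha
      have hP : P ≠ 0 := by rintro rfl; simp at ha0
      have hR : R ≠ 0 := by rintro rfl; simp at ha0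
      rw [div_eq_mul_inv]
      exact (hall' P hP).mul (hall' R hR).inv
    have hres : ∀ a : F, IsTame v w a → w a = 1 → resid w a ∈ L := fun a ha h =>
      mem_algebraicClosure_iff.2 (ha.isAlgebraic_resid h)
    have hM : ∀ a ∈ E, w a ≤ 1 → resid w a ∈ L := by
      intro a ha hle
      rcases hle.lt_or_eq with hlt | heq
      · rw [resid_eq_zero hlt]; exact zero_mem _
      · exact hres a (htame a ha (by rintro rfl; simp at heq)) heq
    have htop : L = ⊤ := by
      by_cases hψ : ∃ ψ ∈ E, w (ψ * y) = 1
      · obtain ⟨ψ, hψE, hψ⟩ := hψ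
        have hψ0 : ψ ≠ 0 := by rintro rfl; simp at hψ
        exact eq_top_of_resid_mem (exists_eq_add_mul_mul hE hψE hψ0) L hM h2 harch (hsq ψ hψE) hψ
          (hres _ ((htame ψ hψE hψ0).mul hytame) hψ)
      · exact eq_top_of_forall_val_ne_one hE L hM hψ
    obtain ⟨r, hr⟩ := htr
    exact hr (mem_algebraicClosure_iff.1 (htop ▸ IntermediateField.mem_top : r ∈ L))
  classical
  obtain ⟨Q, hQ0, hQt, hQd⟩ := Nat.find_spec hex
  have hQmin : ∀ S : K[X], S ≠ 0 → S.degree < Q.degree → IsTame v w (aeval x S) := by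
    intro S hS hlt
    by_contra h
    exact Nat.find_min hex (hQd ▸ natDegree_lt_natDegree hS hlt) ⟨S, hS, h, rfl⟩
  have hQpos : 0 < Q.natDegree := by
    by_contra h
    rw [eq_C_of_natDegree_eq_zero (Nat.eq_zero_of_not_pos h)] at hQt hQ0
    refine hQt ?_
    rw [aeval_C]
    exact isTame_algebraMap (by simpa using hQ0)
  set q := aeval x Q
  have hq0 : q ≠ 0 := hx0 Q hQ0
  have hqE : q ∈ E := aeval_mem_adjoin_simple x Q
  let G : Submonoid F := tameMonoid v w ⊓ E.toSubfield.toSubring.toSubmonoid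
  have hGE : ∀ g ∈ G, g ∈ E := fun g hg => hg.2
  have hGt : ∀ g ∈ G, IsTame v w g := fun g hg => hg.1
  have hexe : ∃ e : ℕ, 0 < e ∧ ∃ s ∈ G, w (q ^ e) = w s := by
    obtain ⟨n, hn, c, hc, h⟩ := hrat q hq0
    exact ⟨n, hn, _, ⟨isTame_algebraMap hc, E.algebraMap_mem c⟩, h⟩
  obtain ⟨hepos, s, hsG, hqs⟩ := Nat.find_spec hexe
  set e := Nat.find hexe with he
  have H : ResidueFrame w x Q G e s :=
    { inv_closed := fun g hg => ⟨(hGt g hg).inv, E.inv_mem (hGE g hg)⟩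
      ne_zero := fun g hg => (hGt g hg).ne_zero
      natDegree_pos := hQpos
      aeval_mem := fun S hS hlt => ⟨hQmin S hS hlt, aeval_mem_adjoin_simple x S⟩
      pos := hepos
      val_ne := fun r hr hlt g hg h => Nat.find_min hexe hlt ⟨hr, g, hg, h⟩
      mem := hsG
      val_eq := hqs }
  have hGM : ∀ M : IntermediateField (ResF v) (ResF w), L ≤ M → ∀ g ∈ G, w g = 1 →
      resid w g ∈ M ∧ IsAlgebraic (ResF v) (resid w g) := fun M hM g hg h =>
    ⟨hM (mem_algebraicClosure_iff.2 ((hGt g hg).isAlgebraic_resid h)),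
      (hGt g hg).isAlgebraic_resid h⟩
  set Z := resid w (q ^ e / s) with hZdef
  -- An algebraic `Z` would make `q ^ e`, and hence `q`, tame.
  have hZ : Transcendental (ResF v) Z := by
    intro halg
    have h1 : IsTame v w (q ^ e / s) := .of_isAlgebraic H.val_div halg
    have h2 := h1.mul (hGt s hsG)
    rw [div_mul_cancel₀ _ (hGt s hsG).ne_zero] at h2
    exact hQt (h2.of_pow hepos)
  by_cases hψ : ∃ ψ ∈ E, w (ψ * y) = 1
  · obtain ⟨ψ, hψE, hψ⟩ := hψ
    have hψ0 : ψ ≠ 0 := by rintro rfl; simp at hψ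
    obtain ⟨g, hg, m, p, hgm, hp, -⟩ := H.exists_normal_form ⊤ (hGM ⊤ le_top) hZ
      IntermediateField.mem_top hψE hψ0
    -- Dropping the unit `p` keeps the value of `ψ * y` and makes its square an element of `G` times
    -- a power of `q`.
    set ψ₁ := g * q ^ m
    have hψ₁E : ψ₁ ∈ E := mul_mem (hGE g hg) (zpow_mem hqE m)
    have hψ₁0 : ψ₁ ≠ 0 := mul_ne_zero (hGt g hg).ne_zero (zpow_ne_zero _ hq0)
    have hy₁ : w (ψ₁ * y) = 1 := by
      rw [← hψ, hgm, map_mul w, map_mul w (ψ₁ * p), map_mul w ψ₁ p, hp, mul_one]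
    have hy₁sq : (ψ₁ * y) ^ 2 = y ^ 2 * g ^ 2 * q ^ (2 * m) := by
      have : q ^ (2 * m) = (q ^ m) ^ 2 := by rw [mul_comm, zpow_mul]; norm_cast
      rw [this]
      simp only [ψ₁]; ring
    obtain ⟨n, -, g', hg', hwg', hn⟩ := H.exists_eq_of_val_eq
      (g := y ^ 2 * g ^ 2) (n := 2 * m)
      ⟨hy.mul (hGt _ (pow_mem hg 2)), mul_mem hyE (pow_mem (hGE g hg) 2)⟩
      (by rw [← hy₁sq, map_pow, hy₁, one_pow])
    set ζ := resid w (ψ₁ * y)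
    have hζ : ζ ^ 2 = resid w g' * Z ^ n := by
      rw [← resid_pow hy₁.le, hy₁sq, hn, resid_mul hwg'.le (by simp [H.val_div]),
        resid_zpow H.val_div]
    have hc : IsAlgebraic (ResF v) (resid w g') := (hGt g' hg').isAlgebraic_resid hwg'
    have hc0 : resid w g' ≠ 0 := resid_ne_zero hwg'
    have hZ0 : Z ≠ 0 := resid_ne_zero H.val_div
    have htop : ∀ M : IntermediateField (ResF v) (ResF w), L ≤ M → Z ∈ M → ζ ∈ M → M = ⊤ :=
      fun M hLM hZM hζM => eq_top_of_resid_mem (exists_eq_add_mul_mul hE hψ₁E hψ₁0) M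
        (fun a ha hle => H.resid_mem M (hGM M hLM) hZ hZM ha hle) h2 harch (hsq _ hψ₁E) hy₁ hζM
    -- For even `n`, `ζ / Z ^ j` is algebraic and `Z` generates over `L`. For odd `n`, its square is
    -- an algebraic element times `Z`, so `ζ / Z ^ j` generates.
    rcases Int.even_or_odd' n with ⟨j, rfl | rfl⟩
    · refine IsRuledExtension.of_adjoin L hZ fun M hLM hZM => htop M hLM hZM ?_
      have h1 : (ζ / Z ^ j) ^ 2 = resid w g' := by
        rw [div_pow, hζ, mul_comm 2 j, zpow_mul]
        have := zpow_ne_zero j hZ0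
        norm_cast
        field_simp
      have h3 : ζ / Z ^ j ∈ M :=
        hLM (mem_algebraicClosure_iff.2 (IsAlgebraic.of_pow two_pos (h1 ▸ hc)))
      have := mul_mem h3 (zpow_mem hZM j)
      rwa [div_mul_cancel₀ _ (zpow_ne_zero j hZ0)] at this
    · have h1 : (ζ / Z ^ j) ^ 2 = resid w g' * Z := by
        rw [div_pow, hζ, mul_comm 2 j, zpow_add₀ hZ0, zpow_mul, zpow_one]
        have := zpow_ne_zero j hZ0
        norm_cast
        field_simp
      have hZeq : Z = (ζ / Z ^ j) ^ 2 * (resid w g')⁻¹ := by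
        rw [h1]; field_simp
      refine IsRuledExtension.of_adjoin L (Z := ζ / Z ^ j) ?_ fun M hLM hζM => ?_
      · intro halg
        refine hZ ?_
        rw [hZeq]
        exact (halg.pow 2).mul hc.inv
      · have hZM : Z ∈ M := by
          rw [hZeq]
          exact mul_mem (pow_mem hζM 2) (inv_mem (hLM (mem_algebraicClosure_iff.2 hc)))
        refine htop M hLM hZM ?_
        have := mul_mem hζM (zpow_mem hZM j)
        rwa [div_mul_cancel₀ _ (zpow_ne_zero j hZ0)] at this
  · exact IsRuledExtension.of_adjoin L hZ fun M hLM hZM => eq_top_of_forall_val_ne_one hE M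
      (fun a ha hle => H.resid_mem M (hGM M hLM) hZ hZM ha hle) hψ

end TameCase

/-! ### Values and residues of the quadratic factors. -/

section QuadraticFactors

variable {K F Γ₀ Γ : Type*} [Field K] [Field F] [Algebra K F]
  [LinearOrderedCommGroupWithZero Γ₀] [LinearOrderedCommGroupWithZero Γ]
  {v : Valuation K Γ₀} {w : Valuation F Γ} [v.HasExtension w]

/-- Dividing by the square of the dominant term leaves a unit with algebraic residue; at a tie,
cancellation is excluded because `-1` is not a residual square. -/
theorem IsTame.add_sq (hi : ¬ ∃ i : ResF w, i ^ 2 = -1) {z : F} (hz : IsTame v w z) {b : K}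
    (hb : b ≠ 0) : IsTame v w (z ^ 2 + algebraMap K F b ^ 2) := by
  have hz0 := hz.ne_zero
  have hb0 : algebraMap K F b ≠ 0 := by simpa using hb
  have hbt : IsTame v w (algebraMap K F b) := isTame_algebraMap hb
  have hwz : w z ≠ 0 := by simpa using hz0
  have hwb : w (algebraMap K F b) ≠ 0 := by simpa using hb
  rcases lt_trichotomy (w z) (w (algebraMap K F b)) with h | h | h
  · have h1 : IsTame v w ((z / algebraMap K F b) ^ 2 + 1) := by
      apply IsTame.of_sub_one_lt
      rw [add_sub_cancel_right, map_pow, map_div₀]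
      exact pow_lt_one₀ zero_le ((div_lt_one₀ (zero_lt_iff.2 hwb)).2 h) two_ne_zero
    convert h1.mul (hbt.mul hbt) using 1
    field_simp
  · have hu : w (z / algebraMap K F b) = 1 := by rw [map_div₀, h, div_self hwb]
    have halg : IsAlgebraic (ResF v) (resid w (z / algebraMap K F b)) := by
      rw [div_eq_mul_inv] at hu ⊢
      exact (hz.mul hbt.inv).isAlgebraic_resid hu
    obtain ⟨h1, h2⟩ := val_add_sq_eq_one hi hu.le (b := 1) (by simp) (Or.inl (resid_ne_zero hu))
    have h3 : IsTame v w ((z / algebraMap K F b) ^ 2 + 1 ^ 2) := by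
      refine .of_isAlgebraic h1 ?_
      rw [h2, resid_one]
      exact (halg.pow 2).add (isAlgebraic_one.pow 2)
    convert h3.mul (hbt.mul hbt) using 1
    field_simp
  · have h1 : IsTame v w (1 + (algebraMap K F b / z) ^ 2) := by
      apply IsTame.of_sub_one_lt
      rw [add_sub_cancel_left, map_pow, map_div₀]
      exact pow_lt_one₀ zero_le ((div_lt_one₀ (zero_lt_iff.2 hwz)).2 h) two_ne_zero
    convert h1.mul (hz.mul hz) using 1
    field_simp

theorem isTame_aeval_of_mem_quadMonoid (hi : ¬ ∃ i : ResF w, i ^ 2 = -1) {x : F}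
    (hx : ∀ a : K, IsTame v w (x - algebraMap K F a)) {N : K[X]} (hN : N ∈ quadMonoid K) :
    IsTame v w (aeval x N) := by
  induction hN using Submonoid.closure_induction with
  | mem N h =>
    obtain ⟨a, b, hb, rfl⟩ := h
    simpa using (hx a).add_sq hi hb
  | one => simpa using isTame_algebraMap (v := v) (w := w) (one_ne_zero (α := K))
  | mul P Q _ _ hP hQ => rw [map_mul]; exact hP.mul hQ

theorem exists_scaled_sum_sq (hi : ¬ ∃ i : ResF w, i ^ 2 = -1) {a b d : F} (hd : d ≠ 0)
    (had : w a ≤ w d) (hbd : w b ≤ w d) (h : w a = w d ∨ w b = w d) :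
    w ((a / d) ^ 2 + (b / d) ^ 2) = 1 ∧ resid w ((a / d) ^ 2 + (b / d) ^ 2) =
      resid w (a / d) ^ 2 + resid w (b / d) ^ 2 := by
  have hwd : w d ≠ 0 := by simpa using hd
  refine val_add_sq_eq_one hi ?_ ?_ ?_
  · rw [map_div₀]; exact div_le_one_of_le₀ had zero_le
  · rw [map_div₀]; exact div_le_one_of_le₀ hbd zero_le
  · refine h.imp (fun h => resid_ne_zero ?_) fun h => resid_ne_zero ?_ <;>
    rw [map_div₀, h, div_self hwd]

theorem isAlgebraic_resid_div {a d : K} (h : w (algebraMap K F a) ≤ w (algebraMap K F d)) :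
    IsAlgebraic (ResF v) (resid w (algebraMap K F a / algebraMap K F d)) := by
  have : w (algebraMap K F (a / d)) ≤ 1 := by
    rw [map_div₀, map_div₀]; exact div_le_one_of_le₀ h zero_le
  rw [← map_div₀, resid_algebraMap v w ((Valuation.HasExtension.val_map_le_one_iff v w _).1 this)]
  exact isAlgebraic_algebraMap _

/-- If the value of `x - a` is not the value of a constant, then products of quadratic polynomials
take at `x` values that are tame up to squares. -/
theorem exists_isTame_mul_sq_of_mem_quadMonoid (hi : ¬ ∃ i : ResF w, i ^ 2 = -1) {x : F} {a : K}
    (ha0 : x - algebraMap K F a ≠ 0)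
    (ha : ∀ c : K, w (x - algebraMap K F a) ≠ w (algebraMap K F c)) {N : K[X]}
    (hN : N ∈ quadMonoid K) : ∃ τ, IsTame v w τ ∧ ∃ φ ∈ IntermediateField.adjoin K {x}, φ ≠ 0 ∧
      aeval x N = τ * φ ^ 2 := by
  induction hN using Submonoid.closure_induction with
  | mem N h =>
    obtain ⟨a', b, hb, rfl⟩ := h
    set z := x - algebraMap K F a
    have hzE : z ∈ IntermediateField.adjoin K {x} :=
      sub_mem (IntermediateField.mem_adjoin_simple_self K x)
        (IntermediateField.algebraMap_mem _ _)
    have hwz : w z ≠ 0 := by simpa using ha0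
    have hb0 : algebraMap K F b ≠ 0 := by simpa using hb
    have heval : aeval x ((X - C a') ^ 2 + C (b ^ 2)) =
        (z + algebraMap K F (a - a')) ^ 2 + algebraMap K F b ^ 2 := by
      simp [z]
    rw [heval]
    set α := a - a'
    -- If `z` dominates, `z ^ 2` is the square to split off and the quotient is a unit with residue
    -- `1`. Otherwise a constant `d` dominates, strictly over `z` because `w z` is not the value of
    -- a constant.
    by_cases hlt : w (algebraMap K F α) < w z ∧ w (algebraMap K F b) < w z
    · refine ⟨(1 + algebraMap K F α / z) ^ 2 + (algebraMap K F b / z) ^ 2, ?_, z, hzE, ha0, ?_⟩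
      · apply IsTame.of_sub_one_lt
        have h1 : w (algebraMap K F α / z) < 1 := by
          rw [map_div₀]; exact (div_lt_one₀ (zero_lt_iff.2 hwz)).2 hlt.1
        have h2 : w (algebraMap K F b / z) < 1 := by
          rw [map_div₀]; exact (div_lt_one₀ (zero_lt_iff.2 hwz)).2 hlt.2
        have heq : (1 + algebraMap K F α / z) ^ 2 + (algebraMap K F b / z) ^ 2 - 1 =
          algebraMap K F α / z * (2 + algebraMap K F α / z) + (algebraMap K F b / z) ^ 2 := by ring
        rw [heq]
        refine w.map_add_lt ?_ ?_
        · rw [map_mul]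
          refine mul_lt_one_of_lt_of_le h1 (w.map_add_le ?_ h1.le)
          rw [← one_add_one_eq_two]
          exact w.map_add_le (by simp) (by simp)
        · rw [map_pow]; exact pow_lt_one₀ zero_le h2 two_ne_zero
      · field_simp
    · obtain ⟨d, hd0, hαd, hbd, hd⟩ : ∃ d : K, d ≠ 0 ∧
          w (algebraMap K F α) ≤ w (algebraMap K F d) ∧
          w (algebraMap K F b) ≤ w (algebraMap K F d) ∧
          (w (algebraMap K F α) = w (algebraMap K F d) ∨
            w (algebraMap K F b) = w (algebraMap K F d)) := by
        rcases le_total (w (algebraMap K F α)) (w (algebraMap K F b)) with h | h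
        · exact ⟨b, hb, h, le_rfl, Or.inr rfl⟩
        · refine ⟨α, ?_, le_rfl, h, Or.inl rfl⟩
          intro h0
          rw [h0, map_zero, map_zero, le_zero_iff, map_eq_zero] at h
          exact hb0 h
      have hd0' : algebraMap K F d ≠ 0 := by simpa using hd0
      have hwd : w (algebraMap K F d) ≠ 0 := by simpa using hd0
      have hzd : w z < w (algebraMap K F d) := by
        refine lt_of_le_of_ne (not_lt.1 fun h => hlt ⟨hαd.trans_lt h, hbd.trans_lt h⟩) (ha d)
      have hzα : w (z + algebraMap K F α) ≤ w (algebraMap K F d) := w.map_add_le hzd.le hαd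
      have hres : resid w ((z + algebraMap K F α) / algebraMap K F d) =
          resid w (algebraMap K F α / algebraMap K F d) := by
        refine resid_eq_of_sub_lt ?_ ?_
        · rw [map_div₀]; exact div_le_one_of_le₀ hαd zero_le
        · rw [← sub_div, add_sub_cancel_right, map_div₀]
          exact (div_lt_one₀ (zero_lt_iff.2 hwd)).2 hzd
      obtain ⟨h1, h2⟩ := exists_scaled_sum_sq hi hd0' hzα hbd (hd.imp_left fun h => by
        rw [← h] at hzd ⊢
        rw [add_comm]
        exact w.map_add_eq_of_lt_left hzd)
      refine ⟨_, .of_isAlgebraic h1 ?_, algebraMap K F d, IntermediateField.algebraMap_mem _ _,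
        hd0', ?_⟩
      · rw [h2, hres]
        exact ((isAlgebraic_resid_div hαd).pow 2).add ((isAlgebraic_resid_div hbd).pow 2)
      · field_simp
  | one =>
    refine ⟨1, ?_, 1, one_mem _, one_ne_zero, by simp⟩
    simpa using isTame_algebraMap (v := v) (w := w) (one_ne_zero (α := K))
  | mul P Q _ _ hP hQ =>
    obtain ⟨τ, hτ, φ, hφ, hφ0, h⟩ := hP
    obtain ⟨τ', hτ', φ', hφ', hφ0', h'⟩ := hQ
    exact ⟨τ * τ', hτ.mul hτ', φ * φ', mul_mem hφ hφ', mul_ne_zero hφ0 hφ0', by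
      rw [map_mul, h, h']; ring⟩

/-- The reduction of a quadratic factor may degenerate: for `μ = 0` it is constant and a square in a
pythagorean field, for `β = 0` it is visibly a square. -/
theorem exists_sq_mul_quad {k : Type*} [Field k] (hk : ∀ a : k, IsSumSq a → ∃ b, a = b ^ 2)
    (μ α β : k) : ∃ S : k[X], ∃ N ∈ quadMonoid k,
      (C μ * X + C α) ^ 2 + C β ^ 2 = S ^ 2 * N := by
  by_cases hμ : μ = 0
  · obtain ⟨δ, hδ⟩ := hk (α * α + β * β) ((IsSumSq.mul_self _).add (IsSumSq.mul_self _))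
    refine ⟨C δ, 1, one_mem _, ?_⟩
    rw [hμ, ← map_pow C δ, ← hδ]
    simp only [map_zero, map_add, map_mul]; ring
  by_cases hβ : β = 0
  · exact ⟨C μ * X + C α, 1, one_mem _, by simp [hβ]⟩
  refine ⟨C μ, _, Submonoid.subset_closure ⟨-α / μ, β / μ, div_ne_zero hβ hμ, rfl⟩, ?_⟩
  have h1 : C μ * C (-α / μ) = -C α := by rw [← C_mul, mul_div_cancel₀ _ hμ, C_neg]
  have h2 : C μ * C (β / μ) = C β := by rw [← C_mul, mul_div_cancel₀ _ hμ]
  rw [← h2, ← neg_neg (C α), ← h1, map_pow]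
  ring

/-- If `w (x - a) = w c` and the residue `Z` of `(x - a) / c` is transcendental, then products of
quadratic polynomials take at `x` values that are, up to squares of constants, units with residues
of the form `S(Z) ^ 2 * N(Z)`, where `N` is again a product of quadratic polynomials. -/
theorem exists_resid_of_mem_quadMonoid (hi : ¬ ∃ i : ResF w, i ^ 2 = -1)
    (hk : ∀ a : ResF v, IsSumSq a → ∃ b, a = b ^ 2) {x : F} {a c : K} (hc : c ≠ 0)
    (hac : w (x - algebraMap K F a) = w (algebraMap K F c))
    (hZ : Transcendental (ResF v) (resid w ((x - algebraMap K F a) / algebraMap K F c)))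
    {N : K[X]} (hN : N ∈ quadMonoid K) :
    ∃ φ : K, φ ≠ 0 ∧ ∃ r : F, aeval x N = algebraMap K F φ ^ 2 * r ∧ w r = 1 ∧
      ∃ S : (ResF v)[X], ∃ N' ∈ quadMonoid (ResF v),
      resid w r = aeval (resid w ((x - algebraMap K F a) / algebraMap K F c)) (S ^ 2 * N') := by
  set Z := resid w ((x - algebraMap K F a) / algebraMap K F c)
  have hc' : algebraMap K F c ≠ 0 := by simpa using hc
  have hwc : w (algebraMap K F c) ≠ 0 := by simpa using hc
  induction hN using Submonoid.closure_induction with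
  | mem N h =>
    obtain ⟨a', b, hb, rfl⟩ := h
    -- The scaling constant is an entry of largest value among `c`, `a - a'`, `b`. After division by
    -- it that entry becomes `1`, so the reductions of both squares cannot vanish together.
    obtain ⟨d, hd, hmax⟩ := ({c, a - a', b} : Set K).toFinite.toFinset.exists_max_image v
      ⟨c, by simp⟩
    replace hd : d = c ∨ d = a - a' ∨ d = b := by simpa using hd
    have hcd : v c ≤ v d := hmax c (by simp)
    have hαd : v (a - a') ≤ v d := hmax (a - a') (by simp)
    have hbd : v b ≤ v d := hmax b (by simp)
    have hd0 : d ≠ 0 := by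
      rintro rfl
      rw [map_zero, le_zero_iff, map_eq_zero] at hcd
      exact hc hcd
    have hd0' : algebraMap K F d ≠ 0 := by simpa using hd0
    have hle : ∀ u : K, v u ≤ v d → v (u / d) ≤ 1 := fun u hu => by
      rw [map_div₀]; exact div_le_one_of_le₀ hu zero_le
    have hle' : ∀ u : K, v u ≤ v d → w (algebraMap K F (u / d)) ≤ 1 := fun u hu =>
      (Valuation.HasExtension.val_map_le_one_iff v w _).2 (hle u hu)
    set y := (x - algebraMap K F a) / algebraMap K F c
    have hy : w y = 1 := by rw [map_div₀, hac, div_self hwc]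
    have hZ : Transcendental (ResF v) Z := hZ
    set A := algebraMap K F (c / d) * y + algebraMap K F ((a - a') / d)
    have hcy : w (algebraMap K F (c / d) * y) ≤ 1 := by
      rw [map_mul, hy, mul_one]; exact hle' c hcd
    have hA : w A ≤ 1 := w.map_add_le hcy (hle' _ hαd)
    have hresA : resid w A = aeval Z (C (resid v (c / d)) * X + C (resid v ((a - a') / d))) := by
      rw [resid_add hcy (hle' _ hαd), resid_mul (hle' _ hcd) hy.le,
        resid_algebraMap v w (hle _ hcd), resid_algebraMap v w (hle _ hαd)]
      simp only [map_add, map_mul, aeval_C, aeval_X]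
      rfl
    have hresb : resid w (algebraMap K F (b / d)) = aeval Z (C (resid v (b / d))) := by
      rw [resid_algebraMap v w (hle _ hbd), aeval_C]
    have hone : d / d = 1 := div_self hd0
    have hne : resid w A ≠ 0 ∨ resid w (algebraMap K F (b / d)) ≠ 0 := by
      by_contra! hcon
      rw [hresA, hresb] at hcon
      have hinj := (injective_iff_map_eq_zero _).1 (transcendental_iff_injective.1 hZ)
      have h1 := hinj _ hcon.1
      have h2 := hinj _ hcon.2
      have h3 := congrArg (fun p => p.coeff 1) h1
      have h4 := congrArg (fun p => p.coeff 0) h1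
      have h5 := congrArg (fun p => p.coeff 0) h2
      simp at h3 h4 h5
      rcases hd with rfl | rfl | rfl
      · rw [hone, resid_one] at h3; exact one_ne_zero h3
      · rw [hone, resid_one] at h4; exact one_ne_zero h4
      · rw [hone, resid_one] at h5; exact one_ne_zero h5
    obtain ⟨h1, h2⟩ := val_add_sq_eq_one hi hA (hle' _ hbd) hne
    obtain ⟨S, N', hN', hS⟩ := exists_sq_mul_quad hk (resid v (c / d)) (resid v ((a - a') / d))
      (resid v (b / d))
    refine ⟨d, hd0, _, ?_, h1, S, N', hN', ?_⟩
    · simp only [A, y, map_div₀, map_sub, map_add, map_pow, aeval_X, aeval_C]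
      field_simp
      ring
    · rw [h2, ← hS, hresA, hresb, map_add (aeval Z) (_ ^ 2), map_pow, map_pow]
  | one => exact ⟨1, one_ne_zero, 1, by simp, by simp, 1, 1, one_mem _, by simp⟩
  | mul P Q _ _ hP hQ =>
    obtain ⟨φ, hφ, r, h1, h2, S, N, hN, h3⟩ := hP
    obtain ⟨φ', hφ', r', h1', h2', S', N', hN', h3'⟩ := hQ
    refine ⟨φ * φ', mul_ne_zero hφ hφ', r * r', ?_, by simp [h2, h2'], S * S', N * N',
      mul_mem hN hN', ?_⟩
    · rw [map_mul, h1, h1', map_mul]; ring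
    · rw [resid_mul h2.le h2'.le, h3, h3', mul_pow, mul_mul_mul_comm, map_mul (aeval Z) (_ * _)]

end QuadraticFactors

/-! ### Reality of a quadratic extension of `k(Z)`. -/

section Semireal

/-- Let `κ = k(Z)(ζ)` with `ζ² = c N(Z)`, where `N` is a product of quadratic polynomials and
`-c` is not a sum of squares in the real field `k`. Then `κ` is real. -/
theorem isSemireal_of_adjoin_sqrt {k E : Type*} [Field k] [Field E] [Algebra k E] [IsSemireal k]
    {Z ζ : E} (hZ : Transcendental k Z) {c : k} (hc : ¬ IsSumSq (-c)) {N : k[X]}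
    (hN : N ∈ quadMonoid k) (hζ : ζ ^ 2 = algebraMap k E c * aeval Z N)
    (htop : ∀ M : IntermediateField k E, IntermediateField.adjoin k {Z} ≤ M → ζ ∈ M → M = ⊤) :
    IsSemireal E := by
  set M := IntermediateField.adjoin k {Z}
  rw [isSemireal_iff_not_isSumSq_neg_one]
  intro hneg
  have hM1 : ¬ IsSumSq (-1 : M) := by
    intro h
    refine IsSemireal.not_isSumSq_neg_one (R := k) (IsSumSq.of_algebraMap_adjoin hZ ?_)
    rwa [map_neg, map_one]
  let n : M := ⟨aeval Z N, aeval_mem_adjoin_simple Z N⟩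
  have hn : IsSumSq n := by
    obtain ⟨p, q, rfl⟩ := exists_add_sq_of_mem_quadMonoid hN
    have : n = ⟨aeval Z p, aeval_mem_adjoin_simple Z p⟩ * ⟨aeval Z p, aeval_mem_adjoin_simple Z p⟩ +
        ⟨aeval Z q, aeval_mem_adjoin_simple Z q⟩ * ⟨aeval Z q, aeval_mem_adjoin_simple Z q⟩ := by
      apply Subtype.ext
      simp [n, sq]
    rw [this]
    exact (IsSumSq.mul_self _).add (IsSumSq.mul_self _)
  have hn0 : n ≠ 0 := by
    intro h
    have h1 : aeval Z N = 0 := congrArg Subtype.val h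
    exact hZ ⟨N, ne_zero_of_mem_quadMonoid hN, h1⟩
  have hζM : ζ ^ 2 ∈ M := by
    rw [hζ]
    exact mul_mem (IntermediateField.algebraMap_mem _ _) (aeval_mem_adjoin_simple Z N)
  by_cases hmem : ζ ∈ M
  · have hMtop := htop M le_rfl hmem
    have key : ∀ s : E, IsSumSq s → ∃ t : M, (t : E) = s ∧ IsSumSq t := by
      intro s hs
      induction hs with
      | zero => exact ⟨0, rfl, IsSumSq.zero⟩
      | @sq_add a s _ ih =>
        obtain ⟨t, rfl, ht⟩ := ih
        have ha : a ∈ M := hMtop ▸ IntermediateField.mem_top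
        exact ⟨⟨a, ha⟩ * ⟨a, ha⟩ + t, rfl, (IsSumSq.mul_self _).add ht⟩
    obtain ⟨t, h1, h2⟩ := key _ hneg
    have : t = -1 := Subtype.ext h1
    exact hM1 (this ▸ h2)
  -- Expanding squares of `p + q ζ` collects a sum of squares into `a + c N(Z) b` plus a multiple of
  -- `ζ`, with `a`, `b` sums of squares in `k(Z)`.
  · have key : ∀ s : E, IsSumSq s → ∃ a b d : M, IsSumSq a ∧ IsSumSq b ∧
        s = ((a + algebraMap k M c * n * b : M) : E) + d * ζ := by
      intro s hs
      induction hs with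
      | zero => exact ⟨0, 0, 0, IsSumSq.zero, IsSumSq.zero, by simp⟩
      | @sq_add z s _ ih =>
        obtain ⟨a, b, d, ha, hb, rfl⟩ := ih
        obtain ⟨p, hp, q, hq, rfl⟩ := exists_eq_add_mul_of_adjoin_eq_top M hζM htop z
        refine ⟨⟨p, hp⟩ * ⟨p, hp⟩ + a, ⟨q, hq⟩ * ⟨q, hq⟩ + b, 2 * ⟨p, hp⟩ * ⟨q, hq⟩ + d,
          (IsSumSq.mul_self _).add ha, (IsSumSq.mul_self _).add hb, ?_⟩
        have h2 : (n : E) = aeval Z N := rfl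
        have h3 : ((2 : M) : E) = 2 := rfl
        push_cast
        rw [h2, h3]
        linear_combination q ^ 2 * hζ
    obtain ⟨a, b, d, ha, hb, h⟩ := key _ hneg
    have hd : d = 0 := by
      by_contra hd0
      apply hmem
      have hd0' : (d : E) ≠ 0 := by simpa using hd0
      have : ζ = ((-1 - (a + algebraMap k M c * n * b)) / d : M) := by
        push_cast at h ⊢
        field_simp
        linear_combination -h
      rw [this]
      exact Subtype.mem _
    have h' : (-1 : M) = a + algebraMap k M c * n * b := by
      apply Subtype.ext
      rw [hd] at h
      simpa using h
    by_cases hb0 : b = 0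
    · rw [hb0, mul_zero, add_zero] at h'
      exact hM1 (h' ▸ ha)
    -- From `-1 = a + c n b` follows `-c = (1 + a) / (n b)`, a sum of squares in `k(Z)` and
    -- therefore in `k`.
    · refine hc (IsSumSq.of_algebraMap_adjoin hZ ?_)
      have : algebraMap k M (-c) = (1 + a) * (n * b)⁻¹ := by
        rw [map_neg]
        field_simp
        linear_combination h'
      rw [this]
      exact (IsSumSq.one.add ha).mul (hn.mul hb).inv_field

end Semireal

/-! ### The Gauss case: `(x - a)/c` has transcendental residue. -/

section LinearCase

variable {K F Γ₀ Γ : Type*} [Field K] [Field F] [Algebra K F]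
  [LinearOrderedCommGroupWithZero Γ₀] [LinearOrderedCommGroupWithZero Γ]
  {v : Valuation K Γ₀} {w : Valuation F Γ} [v.HasExtension w]

variable (w) in
-- With `Q = X - a`, polynomials of smaller degree are constants, so `G` consists of the nonzero
-- constants and `e = 1`.
theorem residueFrame_linear {x : F} {a c : K} (hc : c ≠ 0)
    (hac : w (x - algebraMap K F a) = w (algebraMap K F c)) :
    ResidueFrame w x (X - C a) ((nonZeroDivisors K).map (algebraMap K F)) 1
      (algebraMap K F c) where
  inv_closed := by
    rintro _ ⟨d, hd, rfl⟩
    exact ⟨d⁻¹, by simpa using hd, by simp⟩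
  ne_zero := by
    rintro _ ⟨d, hd, rfl⟩
    simpa using hd
  natDegree_pos := by simp
  aeval_mem := by
    intro S hS hlt
    rw [degree_X_sub_C] at hlt
    have h := eq_C_of_degree_le_zero (Nat.WithBot.lt_one_iff_le_zero.1 hlt)
    rw [h] at hS ⊢
    exact ⟨S.coeff 0, by simpa using hS, by simp⟩
  pos := one_pos
  val_ne := fun r h1 h2 => by omega
  mem := ⟨c, by simpa using hc, rfl⟩
  val_eq := by simpa using hac

theorem isRuledExtension_or_of_linear
    (hhens : HenselianLocalRing v.valuationSubring) [IsSemireal (ResF v)]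
    (hi : ¬ ∃ i : ResF w, i ^ 2 = -1)
    (hk : ∀ a : ResF v, IsSumSq a → ∃ b, a = b ^ 2) [IsSemireal F] {x y : F}
    (hE : ∀ z : F, ∃ a ∈ IntermediateField.adjoin K {x},
      ∃ b ∈ IntermediateField.adjoin K {x}, z = a + b * y)
    (h2 : w 2 = 1) (harch : ∀ a b : F, w a < 1 → ∃ n, w (a ^ n * b) < 1)
    (hyE : y ^ 2 ∈ IntermediateField.adjoin K {x}) {a c : K} (hc : c ≠ 0)
    (hac : w (x - algebraMap K F a) = w (algebraMap K F c))
    (hZ : Transcendental (ResF v) (resid w ((x - algebraMap K F a) / algebraMap K F c)))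
    {c₀ : K} {N : K[X]} (hN : N ∈ quadMonoid K) (hy : y ^ 2 = algebraMap K F c₀ * aeval x N) :
    IsRuledExtension (ResF v) (ResF w) ∨ (IsSemireal (ResF w) ∧
      ∃ h : (ResF v)[X], Squarefree h ∧ RootsInAdjoinSqrtNegOne h ∧
        IsRationalAdjoinSqrt (ResF v) (ResF w) h) := by
  obtain ⟨φ, hφ, r, hNr, hr, S, N', hN', hres⟩ := exists_resid_of_mem_quadMonoid hi hk hc hac hZ hN
  have H := residueFrame_linear w hc hac
  set Z := resid w ((x - algebraMap K F a) / algebraMap K F c) with hZdef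
  have hZ' : resid w (aeval x (X - C a) ^ 1 / algebraMap K F c) = Z := by simp [hZdef]
  set M₀ := IntermediateField.adjoin (ResF v) {Z}
  have hZM₀ : Z ∈ M₀ := IntermediateField.mem_adjoin_simple_self _ Z
  have hGM : ∀ M : IntermediateField (ResF v) (ResF w),
      ∀ g ∈ (nonZeroDivisors K).map (algebraMap K F), w g = 1 →
        resid w g ∈ M ∧ IsAlgebraic (ResF v) (resid w g) := by
    rintro M _ ⟨d, -, rfl⟩ hd
    have hvd : v d ≤ 1 := ((Valuation.HasExtension.val_map_eq_one_iff v w d).1 hd).le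
    have heq := resid_algebraMap v w hvd
    constructor
    · change resid w (algebraMap K F d) ∈ M
      rw [heq]; exact M.algebraMap_mem _
    · change IsAlgebraic (ResF v) (resid w (algebraMap K F d))
      rw [heq]; exact isAlgebraic_algebraMap _
  have hM : ∀ M : IntermediateField (ResF v) (ResF w), Z ∈ M →
      ∀ b ∈ IntermediateField.adjoin K {x}, w b ≤ 1 → resid w b ∈ M := fun M hZM b hb hle =>
    H.resid_mem M (hGM M) (by rwa [hZ']) (by rwa [hZ']) hb hle
  by_cases hψ : ∃ ψ ∈ IntermediateField.adjoin K {x}, w (ψ * y) = 1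
  swap
  · left
    exact IsRuledExtension.of_adjoin ⊥ hZ fun M _ hZM =>
      eq_top_of_forall_val_ne_one hE M (hM M hZM) hψ
  right
  obtain ⟨ψ, hψE, hψ⟩ := hψ
  have hψ0 : ψ ≠ 0 := by rintro rfl; simp at hψ
  obtain ⟨_, ⟨g, hg, rfl⟩, m, p, hgm, hp, -⟩ := H.exists_normal_form M₀ (hGM M₀) (by rwa [hZ'])
    (by rwa [hZ']) hψE hψ0
  -- Since `w (x - a) = w c`, replacing `x - a` by `c` in the normal form of `ψ` gives a constant of
  -- the same value.
  obtain ⟨d, hd0, hd⟩ : ∃ d : K, d ≠ 0 ∧ w (algebraMap K F d * y) = 1 := by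
    have hg0 : g ≠ 0 := by simpa using hg
    refine ⟨g * c ^ m, mul_ne_zero hg0 (zpow_ne_zero m hc), ?_⟩
    have hq : w (aeval x (X - C a)) = w (algebraMap K F c) := by simpa using hac
    rw [← hψ, hgm, map_mul w (_ * _) y, map_mul w _ y, map_mul w _ p, hp, mul_one, map_mul,
      map_mul, map_mul, map_zpow₀, map_zpow₀, map_zpow₀, hq]
  have hd0' : algebraMap K F d ≠ 0 := by simpa using hd0
  have hy0 : y ≠ 0 := by rintro rfl; simp at hd
  set u := d ^ 2 * c₀ * φ ^ 2 with hu
  have hyu : (algebraMap K F d * y) ^ 2 = algebraMap K F u * r := by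
    rw [mul_pow, hy, hNr, hu]; simp only [map_mul, map_pow]; ring
  have hwu : w (algebraMap K F u) = 1 := by
    have := congrArg w hyu
    rw [map_pow, hd, one_pow, map_mul, hr, mul_one] at this
    exact this.symm
  have hvu : v u = 1 := (Valuation.HasExtension.val_map_eq_one_iff v w u).1 hwu
  set ζ := resid w (algebraMap K F d * y)
  have hζ0 : ζ ≠ 0 := resid_ne_zero hd
  have hζ : ζ ^ 2 = algebraMap (ResF v) (ResF w) (resid v u) * (aeval Z S ^ 2 * aeval Z N') := by
    rw [← resid_pow hd.le, hyu, resid_mul hwu.le hr.le, resid_algebraMap v w hvu.le, hres, map_mul,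
      map_pow]
  have hS0 : aeval Z S ≠ 0 := by
    intro h
    rw [h, zero_pow two_ne_zero, zero_mul, mul_zero, sq_eq_zero_iff] at hζ
    exact hζ0 hζ
  have htop : ∀ M : IntermediateField (ResF v) (ResF w), Z ∈ M → ζ ∈ M → M = ⊤ :=
    fun M hZM hζM => eq_top_of_resid_mem
      (exists_eq_add_mul_mul hE (IntermediateField.algebraMap_mem _ d) hd0') M (hM M hZM) h2 harch
      (by rw [mul_pow]; exact mul_mem (pow_mem (IntermediateField.algebraMap_mem _ d) 2) hyE)
      hd hζM
  have hSM : ∀ (M : IntermediateField (ResF v) (ResF w)) (P : (ResF v)[X]), Z ∈ M →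
      aeval Z P ∈ M := fun M P hZM =>
    IntermediateField.adjoin_le_iff.2 (by simpa using hZM) (aeval_mem_adjoin_simple Z P)
  constructor
  · refine isSemireal_of_adjoin_sqrt (ζ := ζ / aeval Z S) (c := resid v u) hZ ?_ hN' ?_ ?_
    · intro hsum
      -- If `-ū` were a square, Hensel would make `-u`, hence `-c₀`, a square in `K`; then `y²` plus
      -- two further squares would vanish in the real field `F`.
      obtain ⟨δ, hδ⟩ := hk _ hsum
      obtain ⟨η, hη⟩ := exists_eq_sq_of_resid_eq_sq v hhens two_ne_zero (u := -u) (δ := δ)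
        (by rwa [Valuation.map_neg]) (by rw [resid_neg hvu.le, hδ])
      obtain ⟨p, q, hpq⟩ := exists_add_sq_of_mem_quadMonoid hN
      set ε := algebraMap K F (η / (d * φ)) with hε
      have hc₀ : algebraMap K F c₀ = -ε ^ 2 := by
        rw [hε, ← map_pow, ← map_neg]
        congr 1
        rw [div_pow, ← hη, hu]
        field_simp
      have hsum0 : (ε * aeval x p) * (ε * aeval x p) + (ε * aeval x q) * (ε * aeval x q) +
          y * y = 0 := by
        have : y * y = -ε ^ 2 * (aeval x p ^ 2 + aeval x q ^ 2) := by
          rw [← sq, hy, hc₀, hpq, map_add, map_pow, map_pow]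
        rw [this]; ring
      have := ((IsSumSq.mul_self _).add (IsSumSq.mul_self _)).eq_zero_of_add_eq_zero
        (IsSumSq.mul_self y) hsum0
      exact hy0 (mul_self_eq_zero.1 this)
    · rw [div_pow, hζ]
      field_simp
    · intro M hM₀M hζM
      have hZM : Z ∈ M := hM₀M hZM₀
      refine htop M hZM ?_
      have := mul_mem hζM (hSM M S hZM)
      rwa [div_mul_cancel₀ _ hS0] at this
  · have hu0 : resid v u ≠ 0 := resid_ne_zero hvu
    -- Take the squarefree part of `ū N'`; it divides `N'`, so it inherits the condition on the
    -- roots.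
    obtain ⟨h, s, hh, hhs⟩ := exists_squarefree_mul_sq
      (mul_ne_zero (C_ne_zero.2 hu0) (ne_zero_of_mem_quadMonoid hN'))
    have hik : ¬ ∃ i : ResF v, i ^ 2 = -1 := by
      rintro ⟨i, h⟩
      exact hi ⟨algebraMap (ResF v) (ResF w) i, by rw [← map_pow, h, map_neg, map_one]⟩
    have hdvd : h ∣ N' := (IsUnit.dvd_mul_left (isUnit_C.2 hu0.isUnit)).1 ⟨s ^ 2, hhs⟩
    have hζ2 : ζ ^ 2 = aeval Z S ^ 2 * (aeval Z h * aeval Z s ^ 2) := by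
      rw [← map_pow (aeval Z) s, ← map_mul (aeval Z) h, ← hhs, hζ, map_mul (aeval Z) (C _), aeval_C,
        mul_left_comm]
    have hs0 : aeval Z s ≠ 0 := by
      intro h0
      rw [h0, zero_pow two_ne_zero, mul_zero, mul_zero, sq_eq_zero_iff] at hζ2
      exact hζ0 hζ2
    refine ⟨h, hh, (rootsInAdjoin_of_mem_quadMonoid hik hN').of_dvd hdvd, Z,
      ζ / (aeval Z S * aeval Z s), hZ, ?_, ?_⟩
    · rw [div_pow, hζ2]
      field_simp
    · have hZM : Z ∈ IntermediateField.adjoin (ResF v) {Z, ζ / (aeval Z S * aeval Z s)} :=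
        IntermediateField.subset_adjoin _ _ (by simp)
      refine htop _ hZM ?_
      have := mul_mem (IntermediateField.subset_adjoin (ResF v)
        {Z, ζ / (aeval Z S * aeval Z s)} (show _ ∈ _ from Or.inr rfl))
        (mul_mem (hSM _ S hZM) (hSM _ s hZM))
      rwa [div_mul_cancel₀ _ (mul_ne_zero hS0 hs0)] at this

end LinearCase

theorem mainTheorem8 {K : Type*} [Field K]
    (v : Valuation K (WithZero (Multiplicative ℤ))) (hv : Function.Surjective v)
    (hhens : HenselianLocalRing v.valuationSubring)
    (hres : IsHereditarilyPythagorean (IsLocalRing.ResidueField v.valuationSubring))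
    (g : ℕ) (f : K[X]) (hsqf : Squarefree f) (hdeg : f.natDegree = 2 * g + 2)
    (hroots : RootsInAdjoinSqrtNegOne f)
    {F : Type*} [Field F] [Algebra K F] (hF : IsRationalAdjoinSqrt K F f) (hreal : IsSemireal F)
    {Γ : Type*} [LinearOrderedCommGroupWithZero Γ] (w : Valuation F Γ) [v.HasExtension w]
    (hw : Algebra.Transcendental (IsLocalRing.ResidueField v.valuationSubring)
      (IsLocalRing.ResidueField w.valuationSubring)) :
    (¬ IsSemireal (IsLocalRing.ResidueField w.valuationSubring) ∧
      fieldLevel (IsLocalRing.ResidueField w.valuationSubring) = 1) ∨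
    IsRuledExtension (IsLocalRing.ResidueField v.valuationSubring)
      (IsLocalRing.ResidueField w.valuationSubring) ∨
    (IsSemireal (IsLocalRing.ResidueField w.valuationSubring) ∧
      ∃ h : (IsLocalRing.ResidueField v.valuationSubring)[X],
        Squarefree h ∧ RootsInAdjoinSqrtNegOne h ∧
        IsRationalAdjoinSqrt (IsLocalRing.ResidueField v.valuationSubring)
          (IsLocalRing.ResidueField w.valuationSubring) h) := by
  by_cases hi : ∃ i : ResF w, i ^ 2 = -1
  · obtain ⟨i, hi⟩ := hi
    exact Or.inl (level_one_of_sq_eq_neg_one hi)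
  right
  have hkreal : IsSemireal (ResF v) := hres.1
  have hk : ∀ a : ResF v, IsSumSq a → ∃ b, a = b ^ 2 := fun a ha =>
    exists_eq_sq_of_pythagorasNumber_eq_one (hres.2 (ResF v) hres.1) ha
  obtain ⟨r, hr⟩ := hw.transcendental
  obtain ⟨t, ht, rfl⟩ := exists_resid_eq r
  obtain ⟨x, y, hx, hxy, htop⟩ := hF
  obtain ⟨c₀, hc₀, N, hN, rfl⟩ := exists_eq_C_mul_quad hsqf.ne_zero hroots
  have hfin := finiteDimensional_adjoin_of_transcendental hxy htop
    (transcendental_of_resid v w ht hr)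
  have hrat : ∀ z : F, z ≠ 0 →
      ∃ n : ℕ, 0 < n ∧ ∃ c : K, c ≠ 0 ∧ w (z ^ n) = w (algebraMap K F c) := fun z hz =>
    exists_pow_val_eq v w ht hr inferInstance hz
  have hLfin := finiteDimensional_of_isAlgebraic_resid v w ht hr
    (algebraicClosure (ResF v) (ResF w))
  have harch := exists_val_pow_mul_lt_one v w hrat
  -- The real residue field of `v` has characteristic zero.
  have h2 : w 2 = 1 := by
    have hle : w (1 + 1) ≤ 1 := w.map_add_le (by simp) (by simp)
    rw [← one_add_one_eq_two]
    refine val_eq_one_of_resid_ne_zero hle ?_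
    rw [resid_add (by simp) (by simp), resid_one]
    intro h
    have h1 : algebraMap (ResF v) (ResF w) (1 + 1) = 0 := by rw [map_add, map_one, h]
    rw [map_eq_zero, one_add_one_eq_two] at h1
    exact two_ne_zero h1
  have hyE : y ^ 2 ∈ IntermediateField.adjoin K {x} := hxy ▸ aeval_mem_adjoin_simple x _
  have hE := exists_eq_add_mul_of_adjoin_eq_top (IntermediateField.adjoin K {x}) hyE
    fun M hM hy => by
      rw [eq_top_iff, ← htop, IntermediateField.adjoin_le_iff]
      rintro z (rfl | rfl)
      · exact hM (IntermediateField.mem_adjoin_simple_self K _)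
      · exact hy
  rw [map_mul, aeval_C] at hxy
  have hc₀t : IsTame v w (algebraMap K F c₀) := isTame_algebraMap hc₀
  by_cases htame : ∀ a : K, IsTame v w (x - algebraMap K F a)
  · left
    exact isRuledExtension_of_isTame hx hE hrat h2 harch ⟨_, hr⟩ hyE
      (hxy ▸ hc₀t.mul (isTame_aeval_of_mem_quadMonoid hi htame hN : IsTame v w _))
  push Not at htame
  obtain ⟨a, ha⟩ := htame
  have ha0 : x - algebraMap K F a ≠ 0 := by
    intro h
    refine hx ⟨X - C a, X_sub_C_ne_zero a, by simpa using h⟩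
  -- Some `x - a` is not tame. If it has the value of a constant `c`, the residue of `(x - a)/c`
  -- must be transcendental; otherwise `N(x)` is tame up to the square of `φ`, and `y` is replaced
  -- by `φ⁻¹ * y`.
  by_cases hac : ∃ c : K, w (x - algebraMap K F a) = w (algebraMap K F c)
  · obtain ⟨c, hac⟩ := hac
    have hc : c ≠ 0 := by
      rintro rfl
      rw [map_zero, map_zero, map_eq_zero] at hac
      exact ha0 hac
    refine isRuledExtension_or_of_linear hhens hi hk hE h2 harch hyE hc hac ?_ hN hxy
    intro halg
    have hwc : w (algebraMap K F c) ≠ 0 := by simpa using hc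
    have h1 : IsTame v w ((x - algebraMap K F a) / algebraMap K F c) :=
      .of_isAlgebraic (by rw [map_div₀, hac, div_self hwc]) halg
    have h3 : IsTame v w _ := h1.mul (isTame_algebraMap hc)
    rw [div_mul_cancel₀ _ (by simpa using hc)] at h3
    exact ha h3
  · left
    push Not at hac
    obtain ⟨τ, hτ, φ, hφE, hφ0, hNφ⟩ :=
      exists_isTame_mul_sq_of_mem_quadMonoid (v := v) hi ha0 hac hN
    have hsq : (φ⁻¹ * y) ^ 2 = algebraMap K F c₀ * τ := by
      rw [mul_pow, hxy, hNφ]; field_simp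
    exact isRuledExtension_of_isTame hx
      (exists_eq_add_mul_mul hE (inv_mem hφE) (inv_ne_zero hφ0)) hrat h2 harch ⟨_, hr⟩
      (by rw [mul_pow]; exact mul_mem (pow_mem (inv_mem hφE) 2) hyE) (hsq ▸ hc₀t.mul hτ)
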